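/- **Setting.** A finite non-empty stream of items $\langle e,v\rangle$ (key $e$ from a countable key set, real value $v>0$) is given; $f(e)$ is the sum of the values of the items with key $e$, and $N=\sum_e f(e)$. **ReliableSketch.** The sketch has $d$ layers; layer $i$ has $w_i$ buckets, a threshold $\lambda_i$ and a hash function $h_i$ from keys to its buckets. All the values $h_i(e)$ ($1\le i\le d$, $e$ a key) are independent, $h_i(e)$ being uniform on the $w_i$ buckets of layer $i$. A bucket stores $(ID,YES,NO)$, initially $(\text{null},0,0)$. To insert $\langle e,v\rangle$, go through the layers $i=1,\dots,d$, each time taking bucket $h_i(e)$ of layer $i$: (a) if $ID=e$, add $v$ to $YES$ and return; (b) otherwise, if $NO+v>\lambda_i$ and $YES>\lambda_i$, replace $v$ by $v-(\lambda_i-NO)$, then set $NO$ to $\lambda_i$ and continue with the next layer; (c) otherwise add $v$ to $NO$, and if now $NO\ge YES$, set $ID$ to $e$ and swap $YES$ and $NO$; return. A value left after layer $d$ is inserted, with key $e$, into a SpaceSaving summary with $m$ counters: the counter of $e$ is increased by $v$ if $e$ is monitored; otherwise $e$ gets a free counter with value $v$ if there is one, and else takes over a least counter, which is increased by $v$. To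 compute the estimate $\hat f(e)$, go through the layers $i=1,\dots,d$, adding up $YES$ if $ID=e$ and $NO$ otherwise for bucket $h_i(e)$ of layer $i$, and stop after the first layer where $NO<\lambda_i$ or $YES=NO$ or $ID=e$. If no layer stops the query, add the SpaceSaving estimate of $e$: its counter if it is monitored, otherwise $0$ if a counter is free and the least counter if none is. **Theorem.** Let $R_w>1$, $R_\lambda>1$, $R_wR_\lambda\ge 2$, $\Lambda>0$ and $0<\Delta<\frac14$. Put $$W=\frac{4N(R_wR_\lambda)^6}{\Lambda(R_w-1)(R_\lambda-1)},\qquad w_i=\left\lceil\frac{W(R_w-1)}{R_w^i}\right\rceil,\qquad \lambda_i=\frac{\Lambda(R_\lambda-1)}{R_\lambda^i},$$ $$\Delta_1=2R_w^2R_\lambda^2(R_\lambda-1),\qquad \Delta_2=3\,\frac{R_wR_\lambda^2}{R_\lambda-1}\,\Delta_1=6R_w^3R_\lambda^4 .$$ Let $x$ be the real root of $$\frac{R_\lambda^{x}}{(R_wR_\lambda)^{2^{x}+x}}=\Delta_1\frac{\Lambda}{N}\ln\frac1\Delta ,$$ and let the sketch have $d=\max(\lceil x\rceil,0)$ layers (so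 $d=x$ if $x$ is a natural number), followed by a SpaceSaving summary with $m=\lceil\Delta_2\ln\frac1\Delta\rceil$ counters. Then, after the whole stream has been inserted, $$\Pr\left[\text{for all keys } e:\ |\hat f(e)-f(e)|\le\Lambda\right]\ge 1-\Delta ,$$ and consequently $\Pr\left[|\hat f(e)-f(e)|\le\Lambda\right]\ge 1-\Delta$ for every key $e$. -/

import Mathlib

open MeasureTheory ProbabilityTheory

namespace ReliableSketch

noncomputable section

/-! ### The error-sensible bucket -/

/-- An error-sensible bucket: a candidate key (`none` is the null key) with its positive and
negative votes. -/
structure Bucket (K : Type*) where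
  ID : Option K
  YES : ℝ
  NO : ℝ

/-- The initial bucket. -/
def Bucket.empty (K : Type*) : Bucket K := ⟨none, 0, 0⟩

/-- Insertion of the item `⟨e, v⟩` into a bucket with lock threshold `lam`. The second component is
`none` if the item has been absorbed completely, and `some v'` if the lock was triggered and the
value `v'` is still to be inserted into the following layers. -/
def Bucket.insert {K : Type*} [DecidableEq K] (lam : ℝ) (e : K) (v : ℝ) (B : Bucket K) :
    Bucket K × Option ℝ :=
  if B.ID = some e then (⟨B.ID, B.YES + v, B.NO⟩, none)
  else if lam < B.NO + v ∧ lam < B.YES then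
    (⟨B.ID, B.YES, lam⟩, some (v - (lam - B.NO)))
  else if B.YES ≤ B.NO + v then (⟨some e, B.NO + v, B.YES⟩, none)
  else (⟨B.ID, B.YES, B.NO + v⟩, none)

/-- What a bucket contributes to the estimate of the key `e`. -/
def Bucket.query {K : Type*} [DecidableEq K] (e : K) (B : Bucket K) : ℝ :=
  if B.ID = some e then B.YES else B.NO

/-- The condition under which a query of `e` does not look at the following layers. -/
def Bucket.Stops {K : Type*} (lam : ℝ) (e : K) (B : Bucket K) : Prop :=
  B.NO < lam ∨ B.YES = B.NO ∨ B.ID = some e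

/-! ### SpaceSaving -/

/-- A SpaceSaving summary: the monitored keys with their counters (the value of `count` at a key
that is not monitored is irrelevant). -/
structure SpaceSaving (K : Type*) where
  keys : Finset K
  count : K → ℝ

/-- The initial SpaceSaving summary. -/
def SpaceSaving.empty (K : Type*) : SpaceSaving K := ⟨∅, fun _ => 0⟩

/-- Insertion of `⟨e, v⟩` into a SpaceSaving summary with `m` counters. If `e` is not monitored and
all counters are in use, a monitored key with the least counter is replaced by `e`, which inherits
that counter. -/
def SpaceSaving.insert {K : Type*} [DecidableEq K] (m : ℕ) (e : K) (v : ℝ) (T : SpaceSaving K) :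
    SpaceSaving K :=
  if e ∈ T.keys then ⟨T.keys, Function.update T.count e (T.count e + v)⟩
  else if T.keys.card < m then ⟨Insert.insert e T.keys, Function.update T.count e v⟩
  else if hT : T.keys.Nonempty then
    let a := (T.keys.exists_min_image T.count hT).choose
    ⟨Insert.insert e (T.keys.erase a), Function.update T.count e (T.count a + v)⟩
  else T

/-- The SpaceSaving estimate of `e`: its counter if it is monitored, and otherwise the least
counter, which is `0` as long as some counter is unused. -/
def SpaceSaving.query {K : Type*} [DecidableEq K] (m : ℕ) (e : K) (T : SpaceSaving K) : ℝ :=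
  if e ∈ T.keys then T.count e
  else if T.keys.card < m then 0
  else if hT : T.keys.Nonempty then T.keys.inf' hT T.count
  else 0

/-! ### The sketch

Layers are indexed by `i : Fin d`, which stands for the layer number `i + 1`; layer `i` has `w i`
buckets and lock threshold `lam i`. The hash functions are `h i : K → Fin (w i)`, and `m` is the
number of counters of the SpaceSaving summary that serves as layer `d + 1`. -/

/-- The contents of the sketch. -/
structure Sketch (K : Type*) {d : ℕ} (w : Fin d → ℕ) where
  bucket : (i : Fin d) → Fin (w i) → Bucket K
  last : SpaceSaving K

variable {K : Type*} {d : ℕ} {w : Fin d → ℕ}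

/-- The initial sketch. -/
def Sketch.empty (K : Type*) {d : ℕ} (w : Fin d → ℕ) : Sketch K w :=
  ⟨fun _ _ => Bucket.empty K, SpaceSaving.empty K⟩

/-- Replace the `j`-th bucket of layer `i`. -/
def Sketch.setBucket (S : Sketch K w) (i : Fin d) (j : Fin (w i)) (B : Bucket K) : Sketch K w :=
  ⟨Function.update S.bucket i (Function.update (S.bucket i) j B), S.last⟩

/-- Insertion of `⟨e, v⟩` into the listed layers, one after the other, and of what is then left
into the final SpaceSaving layer. -/
def Sketch.insertLayers [DecidableEq K] (lam : Fin d → ℝ) (m : ℕ) (h : (i : Fin d) → K → Fin (w i))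
    (e : K) : List (Fin d) → ℝ → Sketch K w → Sketch K w
  | [], v, S => ⟨S.bucket, S.last.insert m e v⟩
  | i :: is, v, S =>
    match (S.bucket i (h i e)).insert (lam i) e v with
    | (B, none) => S.setBucket i (h i e) B
    | (B, some v') => Sketch.insertLayers lam m h e is v' (S.setBucket i (h i e) B)

/-- Insertion of the item `⟨e, v⟩ = a`. -/
def Sketch.insert [DecidableEq K] (lam : Fin d → ℝ) (m : ℕ) (h : (i : Fin d) → K → Fin (w i))
    (S : Sketch K w) (a : K × ℝ) : Sketch K w :=
  Sketch.insertLayers lam m h a.1 (List.finRange d) a.2 S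

open Classical in
/-- The estimate of `e` collected from the listed layers and, if none of them stops the query, from
the final SpaceSaving layer. -/
def Sketch.queryLayers [DecidableEq K] (lam : Fin d → ℝ) (m : ℕ) (h : (i : Fin d) → K → Fin (w i))
    (S : Sketch K w) (e : K) : List (Fin d) → ℝ
  | [] => S.last.query m e
  | i :: is =>
    (S.bucket i (h i e)).query e +
      if (S.bucket i (h i e)).Stops (lam i) e then 0 else Sketch.queryLayers lam m h S e is

/-- The sketch after the items of `stream` have been inserted in order. -/
def run [DecidableEq K] (lam : Fin d → ℝ) (m : ℕ) (h : (i : Fin d) → K → Fin (w i))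
    (stream : List (K × ℝ)) : Sketch K w :=
  stream.foldl (Sketch.insert lam m h) (Sketch.empty K w)

/-- The estimate of the value sum of `e` that the sketch reports after processing `stream`. -/
def estimate [DecidableEq K] (lam : Fin d → ℝ) (m : ℕ) (h : (i : Fin d) → K → Fin (w i))
    (stream : List (K × ℝ)) (e : K) : ℝ :=
  (run lam m h stream).queryLayers lam m h e (List.finRange d)

/-- The true value sum of the key `e` in `stream`. -/
def valueSum [DecidableEq K] (stream : List (K × ℝ)) (e : K) : ℝ :=
  ((stream.filter (fun a => a.1 = e)).map Prod.snd).sum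

/-- The total value of `stream`, over all keys. -/
def totalValue (stream : List (K × ℝ)) : ℝ := (stream.map Prod.snd).sum

/-! ### Parameters -/

/-- The size parameter `W`. -/
def sizeParam (N Λ Rw Rl : ℝ) : ℝ := 4 * N * (Rw * Rl) ^ 6 / (Λ * (Rw - 1) * (Rl - 1))

/-- The width of layer `i = 1, 2, …`. -/
def width (N Λ Rw Rl : ℝ) (i : ℕ) : ℕ := ⌈sizeParam N Λ Rw Rl * (Rw - 1) / Rw ^ i⌉₊

/-- The lock threshold of layer `i = 1, 2, …`. -/
def threshold (Λ Rl : ℝ) (i : ℕ) : ℝ := Λ * (Rl - 1) / Rl ^ i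

/-- The constant `Δ₁`. -/
def Delta₁ (Rw Rl : ℝ) : ℝ := 2 * Rw ^ 2 * Rl ^ 2 * (Rl - 1)

/-- The constant `Δ₂`. -/
def Delta₂ (Rw Rl : ℝ) : ℝ := 6 * Rw ^ 3 * Rl ^ 4

/-- `x` is a real root of the equation that determines the depth. -/
def IsDepthRoot (N Λ Δ Rw Rl x : ℝ) : Prop :=
  Rl ^ x / (Rw * Rl) ^ ((2 : ℝ) ^ x + x) = Delta₁ Rw Rl * (Λ / N) * Real.log (1 / Δ)

/-- `h i e ω` is the bucket of layer `i` to which the key `e` is mapped: the hash functions are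
independent, uniformly random functions. -/
structure IsUniformHashing {Ω : Type*} [MeasurableSpace Ω] (P : Measure Ω)
    (h : (i : Fin d) → K → Ω → Fin (w i)) : Prop where
  measurable : ∀ i e, Measurable (h i e)
  indep : iIndepFun (β := fun p : Fin d × K => Fin (w p.1)) (fun p => h p.1 p.2) P
  uniform : ∀ i e (j : Fin (w i)), P.real {ω | h i e ω = j} = 1 / (w i : ℝ)

end

end ReliableSketch

namespace ReliableSketch

noncomputable section

open scoped BigOperators

/-! ### Value sums of streams -/

section Streams

variable {K : Type*}

/-! The deterministic half: a bucket is a majority-vote counter whose `NO` never exceeds its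
threshold and bounds the error on the part of a key absorbed there (`Bucket.Tracks`,
`abs_query_sub_le`). Processing items one by one is the same as sending the whole stream through
layer 1, its overflow through layer 2, and so on (`run_follows`). Hence the total error is at most
λ_1 + ... + λ_d plus the SpaceSaving error on what remains (`abs_estimate_sub_le`). The thresholds
leave room below Λ for a last error of λ_{d+1}/2, so it suffices that the remainder is small with
high probability.

Let f_n be the value sums after n layers, and let G_n be the sum over all keys of min(f_n,
λ_{n+1}/2). The cap keeps a single heavy key from dominating, and G_d < m λ_{d+1}/2 already gives
SpaceSaving error at most λ_{d+1}/2. A bucket overflows only if its keys, with any one of them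
removed, still carry more than the threshold; so overflow requires a genuine collision. With u =
λ/2, throw the capped keys into the bins one at a time and charge each key g * min(1, y/u), where y
is the load already in its bin. An overflowing bin has load at most 4 times its charge
(`sum_le_four_mul_binPotential`), while the exponential moment of the total charge is controlled key
by key, since the average of y is at most G/w (`expect_exp_potential_le`). Markov's inequality then
bounds the probability that G_{n+1} exceeds b by exp(-b / (4 λ_{n+1})), provided b is at least of
order G_n² / (w λ) (`expect_layerRun_le`).

This squaring explains the doubly exponential bounds B_n (`valueBound`): B_0 ≥ N, B_n² is dominated
by B_{n+1} w λ (`IsDepthRoot.sq_valueBound_le`), and the depth equation stops the recursion when B_d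
is of order λ_d ln(1/Δ). The failure probability of the layer after n others is at most Δ^(2(d-n))
(`IsDepthRoot.log_mul_le`), and these sum to at most Δ (`sum_exp_le`). -/

lemma totalValue_nil : totalValue ([] : List (K × ℝ)) = 0 := by simp [totalValue]

lemma totalValue_append (s t : List (K × ℝ)) :
    totalValue (s ++ t) = totalValue s + totalValue t := by simp [totalValue]

lemma totalValue_singleton (a : K × ℝ) : totalValue [a] = a.2 := by simp [totalValue]

variable [DecidableEq K]

lemma valueSum_nil (k : K) : valueSum [] k = 0 := by simp [valueSum]

lemma valueSum_append (s t : List (K × ℝ)) (k : K) :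
    valueSum (s ++ t) k = valueSum s k + valueSum t k := by simp [valueSum]

lemma valueSum_singleton (a : K × ℝ) (k : K) :
    valueSum [a] k = if a.1 = k then a.2 else 0 := by
  by_cases h : a.1 = k <;> simp [valueSum, h]

lemma valueSum_nonneg {s : List (K × ℝ)} (hs : ∀ a ∈ s, 0 < a.2) (k : K) : 0 ≤ valueSum s k := by
  refine List.sum_nonneg fun x hx => ?_
  simp only [List.mem_map, List.mem_filter] at hx
  obtain ⟨a, ⟨ha, -⟩, rfl⟩ := hx
  exact (hs a ha).le

lemma valueSum_le_totalValue {s : List (K × ℝ)} (hs : ∀ a ∈ s, 0 < a.2) (k : K) :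
    valueSum s k ≤ totalValue s := by
  induction s with
  | nil => simp [valueSum_nil, totalValue_nil]
  | cons a s ih =>
    have h1 := ih fun b hb => hs b (List.mem_cons_of_mem _ hb)
    have h2 := hs a List.mem_cons_self
    rw [← List.singleton_append, valueSum_append, totalValue_append, valueSum_singleton,
      totalValue_singleton]
    split_ifs <;> linarith

lemma valueSum_eq_zero {s : List (K × ℝ)} {k : K} (h : ∀ a ∈ s, a.1 ≠ k) : valueSum s k = 0 := by
  have : s.filter (fun a => a.1 = k) = [] := by
    simpa [List.filter_eq_nil_iff] using fun a b hab => h (a, b) hab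
  simp [valueSum, this]

lemma totalValue_eq_sum {s : List (K × ℝ)} {S : Finset K} (h : ∀ a ∈ s, a.1 ∈ S) :
    totalValue s = ∑ k ∈ S, valueSum s k := by
  induction s with
  | nil => simp [valueSum_nil, totalValue_nil]
  | cons a s ih =>
    have h1 := ih fun b hb => h b (List.mem_cons_of_mem _ hb)
    have h2 := h a List.mem_cons_self
    rw [← List.singleton_append, totalValue_append, totalValue_singleton, h1]
    simp only [valueSum_append, valueSum_singleton,
      Finset.sum_add_distrib, Finset.sum_ite_eq, h2, if_true]

lemma valueSum_filter_eq {β : Type*} [DecidableEq β] (hash : K → β) (s : List (K × ℝ)) (k : K) :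
    valueSum (s.filter fun a => hash a.1 = hash k) k = valueSum s k := by
  unfold valueSum
  rw [List.filter_filter]
  congr 2
  refine List.filter_congr fun a _ => ?_
  by_cases h : a.1 = k <;> simp [h]

end Streams

/-! ### Buckets -/

section Buckets

variable {K : Type*} [DecidableEq K]

/-- The state `B` of a bucket is compatible with the bucket having received the items `I`, of which
it has passed on the items `O` to the next layer. -/
structure Bucket.Tracks (lam : ℝ) (B : Bucket K) (I O : List (K × ℝ)) : Prop where
  out_pos : ∀ a ∈ O, 0 < a.2
  no_nonneg : 0 ≤ B.NO
  no_le_yes : B.NO ≤ B.YES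
  no_le : B.NO ≤ lam
  total : totalValue I = totalValue O + (B.YES + B.NO)
  absorbed_of_eq : ∀ k, B.ID = some k → B.YES - B.NO ≤ valueSum I k - valueSum O k ∧
    valueSum I k - valueSum O k ≤ B.YES
  absorbed_of_ne : ∀ k, B.ID ≠ some k → 0 ≤ valueSum I k - valueSum O k ∧
    valueSum I k - valueSum O k ≤ B.NO
  locked : ∀ a ∈ O, B.NO = lam ∧ lam < B.YES ∧ B.ID ≠ some a.1
  overflow : O ≠ [] → ∀ k, lam < totalValue I - valueSum I k

lemma Bucket.tracks_empty {lam : ℝ} (hlam : 0 ≤ lam) :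
    (Bucket.empty K).Tracks lam [] [] := by
  constructor <;> simp [Bucket.empty, totalValue, valueSum, hlam]

/-- A locked bucket stays locked: `NO = lam < YES` sends every further item with a different key to
the lock branch. So the two voting branches only occur while `O` is empty, where the bounds are
those of ordinary majority voting. -/
lemma Bucket.Tracks.insert {lam : ℝ} {B : Bucket K} {I O : List (K × ℝ)} (hB : B.Tracks lam I O)
    (e : K) {v : ℝ} (hv : 0 < v) :
    (B.insert lam e v).1.Tracks lam (I ++ [(e, v)])
      (O ++ ((B.insert lam e v).2.map fun v' => (e, v')).toList) := by
  have hID : ∀ k, k ≠ e → B.ID = some e → B.ID ≠ some k := by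
    intro k hk h1 h2; exact hk (by simpa using h2.symm.trans h1)
  unfold Bucket.insert
  split_ifs with h1 h2 h3
  · simp only [Option.map_none, Option.toList_none, List.append_nil]
    refine ⟨hB.out_pos, hB.no_nonneg, ?_, hB.no_le, ?_, ?_, ?_, ?_, ?_⟩
    · have := hB.no_le_yes; simp only; linarith
    · have := hB.total; simp only [totalValue_append, totalValue_singleton]; linarith
    · intro k hk
      have h := hB.absorbed_of_eq k hk
      have : e = k := by simpa using h1.symm.trans hk
      subst this
      simp only [valueSum_append, valueSum_singleton, if_true]
      exact ⟨by linarith [h.1], by linarith [h.2]⟩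
    · intro k hk
      have : e ≠ k := by rintro rfl; exact hk h1
      simpa [valueSum_append, valueSum_singleton, this] using hB.absorbed_of_ne k hk
    · intro a ha
      obtain ⟨h4, h5, h6⟩ := hB.locked a ha
      exact ⟨h4, by simp only; linarith, h6⟩
    · intro hO k
      have := hB.overflow hO k
      simp only [valueSum_append, valueSum_singleton, totalValue_append, totalValue_singleton]
      split_ifs <;> linarith
  · obtain ⟨h3, h4⟩ := h2
    simp only [Option.map_some, Option.toList_some]
    have hno := hB.no_le
    refine ⟨?_, le_trans hB.no_nonneg hno, h4.le, le_rfl, ?_, ?_, ?_, ?_, ?_⟩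
    · intro a ha
      rw [List.mem_append, List.mem_singleton] at ha
      rcases ha with ha | rfl
      · exact hB.out_pos a ha
      · simp only; linarith
    · have := hB.total; simp only [totalValue_append, totalValue_singleton]; linarith
    · intro k hk
      have h := hB.absorbed_of_eq k hk
      have : e ≠ k := by rintro rfl; exact h1 hk
      simp only [valueSum_append, valueSum_singleton, this, if_false]
      exact ⟨by linarith [h.1], by linarith [h.2]⟩
    · intro k hk
      have h := hB.absorbed_of_ne k hk
      simp only [valueSum_append, valueSum_singleton]
      split_ifs
      · exact ⟨by linarith [h.1], by linarith [h.2]⟩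
      · exact ⟨by linarith [h.1], by linarith [h.2]⟩
    · intro a ha
      rw [List.mem_append, List.mem_singleton] at ha
      rcases ha with ha | rfl
      · exact ⟨rfl, h4, (hB.locked a ha).2.2⟩
      · exact ⟨rfl, h4, h1⟩
    -- If `k` is the candidate, the other keys account for at least `NO + v`; otherwise they account
    -- for at least `YES`. The lock condition makes both exceed `lam`.
    · intro _ k
      have h5 := valueSum_le_totalValue hB.out_pos k
      have h6 := hB.total
      simp only [valueSum_append, valueSum_singleton, totalValue_append, totalValue_singleton]
      by_cases hk : B.ID = some k
      · have : e ≠ k := by rintro rfl; exact h1 hk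
        have := hB.absorbed_of_eq k hk
        simp only [*, if_false]
        linarith
      · have := hB.absorbed_of_ne k hk
        split_ifs <;> linarith
  · have hO : O = [] := by
      by_contra hO
      obtain ⟨a, ha⟩ := List.exists_mem_of_ne_nil O hO
      obtain ⟨h4, h5, -⟩ := hB.locked a ha
      exact h2 ⟨by linarith, h5⟩
    subst hO
    have hT := hB.total
    have he := hB.absorbed_of_ne e h1
    have hle := hB.no_le_yes
    simp only [Option.map_none, Option.toList_none, List.append_nil]
    simp only [totalValue_nil, valueSum_nil, sub_zero] at hT he
    refine ⟨by simp, le_trans hB.no_nonneg hle, h3, ?_, ?_, ?_, ?_, by simp, by simp⟩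
    -- After the swap the new `NO` is the old `YES`; were it above `lam`, then `NO + v ≥ YES > lam`
    -- would have triggered the lock.
    · by_contra h4
      simp only [not_le] at h4
      exact h2 ⟨by linarith, h4⟩
    · simp only [totalValue_append, totalValue_singleton, totalValue_nil]; linarith
    · intro k hk
      have : e = k := by simpa using hk
      subst this
      simp only [valueSum_append, valueSum_singleton, if_true, valueSum_nil]
      exact ⟨by linarith, by linarith⟩
    · intro k hk
      have : e ≠ k := by rintro rfl; exact hk rfl
      simp only [valueSum_append, valueSum_singleton, this, if_false, valueSum_nil]
      by_cases hk' : B.ID = some k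
      · have := hB.absorbed_of_eq k hk'
        simp only [valueSum_nil] at this
        exact ⟨by linarith, by linarith⟩
      · have := hB.absorbed_of_ne k hk'
        simp only [valueSum_nil] at this
        exact ⟨by linarith, by linarith⟩
  · have hO : O = [] := by
      by_contra hO
      obtain ⟨a, ha⟩ := List.exists_mem_of_ne_nil O hO
      obtain ⟨h4, h5, -⟩ := hB.locked a ha
      exact h2 ⟨by linarith, h5⟩
    subst hO
    have hT := hB.total
    have hle := hB.no_le_yes
    have hno := hB.no_nonneg
    rw [not_le] at h3
    simp only [Option.map_none, Option.toList_none, List.append_nil]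
    simp only [totalValue_nil] at hT
    refine ⟨by simp, by simp only; linarith, h3.le, ?_, ?_, ?_, ?_, by simp, by simp⟩
    · by_contra h4
      simp only [not_le] at h4
      exact h2 ⟨by linarith, by linarith⟩
    · simp only [totalValue_append, totalValue_singleton, totalValue_nil]; linarith
    · intro k hk
      have : e ≠ k := by rintro rfl; exact h1 hk
      have := hB.absorbed_of_eq k hk
      simp only [valueSum_append, valueSum_singleton, *, if_false, valueSum_nil] at this ⊢
      exact ⟨by linarith, by linarith⟩
    · intro k hk
      have := hB.absorbed_of_ne k hk
      simp only [valueSum_append, valueSum_singleton, valueSum_nil] at this ⊢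
      split_ifs
      · exact ⟨by linarith, by linarith⟩
      · exact ⟨by linarith, by linarith⟩

end Buckets

/-! ### Layers -/

section Layers

variable {K β : Type*} [DecidableEq K] [DecidableEq β]

/-- Insertion of an item into a layer, given by its buckets and the list of the items it has passed
on to the next layer so far. -/
def layerStep (lam : ℝ) (hash : K → β) (Q : (β → Bucket K) × List (K × ℝ)) (a : K × ℝ) :
    (β → Bucket K) × List (K × ℝ) :=
  (Function.update Q.1 (hash a.1) ((Q.1 (hash a.1)).insert lam a.1 a.2).1,
    Q.2 ++ ((((Q.1 (hash a.1)).insert lam a.1 a.2).2).map fun v' => (a.1, v')).toList)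

/-- The buckets of a layer after the stream `s` has been inserted, and the stream that the layer has
passed on. -/
def layerRun (lam : ℝ) (hash : K → β) (s : List (K × ℝ)) : (β → Bucket K) × List (K × ℝ) :=
  s.foldl (layerStep lam hash) (fun _ => Bucket.empty K, [])

lemma layerRun_append_singleton (lam : ℝ) (hash : K → β) (s : List (K × ℝ)) (a : K × ℝ) :
    layerRun lam hash (s ++ [a]) = layerStep lam hash (layerRun lam hash s) a := by
  simp [layerRun]

/-- The buckets of a layer do not interact: each one sees exactly the substream hashed to it. -/
lemma layerRun_tracks {lam : ℝ} (hlam : 0 ≤ lam) (hash : K → β) {s : List (K × ℝ)}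
    (hs : ∀ a ∈ s, 0 < a.2) (j : β) :
    ((layerRun lam hash s).1 j).Tracks lam (s.filter fun a => hash a.1 = j)
      ((layerRun lam hash s).2.filter fun a => hash a.1 = j) := by
  induction s using List.reverseRecOn with
  | nil => simpa [layerRun] using Bucket.tracks_empty hlam
  | append_singleton s a ih =>
    have ih := ih fun b hb => hs b (by simp [hb])
    have ha := hs a (by simp)
    rw [layerRun_append_singleton]
    unfold layerStep
    by_cases hj : hash a.1 = j
    · subst hj
      have := ih.insert a.1 ha
      simp only [Function.update_self, List.filter_append]
      convert this using 2
      · simp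
      · cases (((layerRun lam hash s).1 (hash a.1)).insert lam a.1 a.2).2 <;> simp
    · have h2 : ∀ o : Option ℝ, ((o.map fun v' => (a.1, v')).toList).filter
          (fun b => decide (hash b.1 = j)) = [] := by
        intro o; cases o <;> simp [hj]
      simp only [Function.update_of_ne (Ne.symm hj), List.filter_append, h2, List.append_nil]
      simpa [hj] using ih

lemma layerRun_out_pos {lam : ℝ} (hlam : 0 ≤ lam) (hash : K → β) {s : List (K × ℝ)}
    (hs : ∀ a ∈ s, 0 < a.2) : ∀ a ∈ (layerRun lam hash s).2, 0 < a.2 := fun a ha =>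
  (layerRun_tracks hlam hash hs (hash a.1)).out_pos a (by simpa using ha)

lemma layerRun_out_keys (lam : ℝ) (hash : K → β) (s : List (K × ℝ)) {S : Finset K}
    (hs : ∀ a ∈ s, a.1 ∈ S) : ∀ a ∈ (layerRun lam hash s).2, a.1 ∈ S := by
  induction s using List.reverseRecOn with
  | nil => simp [layerRun]
  | append_singleton s a ih =>
    have ih := ih fun b hb => hs b (by simp [hb])
    rw [layerRun_append_singleton]
    intro b hb
    simp only [layerStep, List.mem_append] at hb
    rcases hb with hb | hb
    · exact ih b hb
    · have : b.1 = a.1 := by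
        simp only [Option.mem_toList, Option.map_eq_some_iff] at hb
        obtain ⟨v, -, rfl⟩ := hb
        rfl
      rw [this]
      exact hs a (by simp)

lemma layerRun_congr (lam : ℝ) {hash hash' : K → β} {s : List (K × ℝ)}
    (hs : ∀ a ∈ s, hash a.1 = hash' a.1) : layerRun lam hash s = layerRun lam hash' s := by
  induction s using List.reverseRecOn with
  | nil => rfl
  | append_singleton s a ih =>
    rw [layerRun_append_singleton, layerRun_append_singleton,
      ih fun b hb => hs b (by simp [hb])]
    simp [layerStep, hs a (by simp)]

/-- The absorbed part of a key is estimated up to the lock threshold. -/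
lemma abs_query_sub_le {lam : ℝ} (hlam : 0 ≤ lam) (hash : K → β) {s : List (K × ℝ)}
    (hs : ∀ a ∈ s, 0 < a.2) (e : K) :
    |((layerRun lam hash s).1 (hash e)).query e -
      (valueSum s e - valueSum (layerRun lam hash s).2 e)| ≤ lam := by
  have h := layerRun_tracks hlam hash hs (hash e)
  have h1 := h.absorbed_of_eq e
  have h2 := h.absorbed_of_ne e
  have h3 := h.no_le
  have h4 := h.no_nonneg
  rw [valueSum_filter_eq, valueSum_filter_eq] at h1 h2
  unfold Bucket.query
  split_ifs with hID
  · have := h1 hID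
    rw [abs_le]; constructor <;> linarith
  · have := h2 hID
    rw [abs_le]; constructor <;> linarith

/-- A key at whose bucket the query stops has not been passed on. -/
lemma valueSum_out_eq_zero {lam : ℝ} (hlam : 0 ≤ lam) (hash : K → β) {s : List (K × ℝ)}
    (hs : ∀ a ∈ s, 0 < a.2) {e : K}
    (he : ((layerRun lam hash s).1 (hash e)).Stops lam e) :
    valueSum (layerRun lam hash s).2 e = 0 := by
  refine valueSum_eq_zero fun a ha hae => ?_
  subst hae
  obtain ⟨h1, h2, h3⟩ := (layerRun_tracks hlam hash hs (hash a.1)).locked a (by simpa using ha)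
  rcases he with h | h | h
  · exact h.ne h1
  · rw [h1] at h; exact h2.ne' h
  · exact h3 h

end Layers

/-! ### SpaceSaving -/

section SpaceSaving

variable {K : Type*} [DecidableEq K]

/-- The SpaceSaving summary of a stream. -/
def SpaceSaving.run (m : ℕ) (s : List (K × ℝ)) : SpaceSaving K :=
  s.foldl (fun T a => T.insert m a.1 a.2) (SpaceSaving.empty K)

lemma SpaceSaving.run_append_singleton (m : ℕ) (s : List (K × ℝ)) (a : K × ℝ) :
    run m (s ++ [a]) = (run m s).insert m a.1 a.2 := by simp [run]

/-- The summary `T` with `m` counters is compatible with the stream `s`, all counters being at least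
`μ` and overestimating by at most `μ`. -/
structure SpaceSaving.Tracks (m : ℕ) (T : SpaceSaving K) (s : List (K × ℝ)) (μ : ℝ) : Prop where
  nonneg : 0 ≤ μ
  card_le : T.keys.card ≤ m
  sum_count : ∑ k ∈ T.keys, T.count k = totalValue s
  le_count : ∀ k ∈ T.keys, μ ≤ T.count k
  eq_zero : T.keys.card < m → μ = 0
  valueSum_le_count : ∀ k ∈ T.keys, valueSum s k ≤ T.count k
  count_le : ∀ k ∈ T.keys, T.count k ≤ valueSum s k + μ
  valueSum_le : ∀ k ∉ T.keys, valueSum s k ≤ μ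
  keys_subset : ∀ k ∈ T.keys, ∃ a ∈ s, a.1 = k

/-- `μ` changes only on an eviction, where it becomes the evicted counter: the newcomer inherits
that value, and it still bounds the evicted key. -/
lemma SpaceSaving.Tracks.insert {m : ℕ} (hm : 0 < m) {T : SpaceSaving K} {s : List (K × ℝ)} {μ : ℝ}
    (hT : T.Tracks m s μ) {e : K} (hspos : 0 ≤ valueSum s e) {v : ℝ} (hv : 0 < v) :
    ∃ μ', (T.insert m e v).Tracks m (s ++ [(e, v)]) μ' := by
  have hsub : ∀ k, (k = e ∨ k ∈ T.keys) → ∃ a ∈ s ++ [(e, v)], a.1 = k := by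
    rintro k (rfl | hk)
    · exact ⟨(k, v), by simp, rfl⟩
    · obtain ⟨a, ha, rfl⟩ := hT.keys_subset k hk
      exact ⟨a, by simp [ha], rfl⟩
  have hne : ∀ k, k ≠ e → valueSum (s ++ [(e, v)]) k = valueSum s k := by
    intro k hk; simp [valueSum_append, valueSum_singleton, hk.symm]
  have heq : valueSum (s ++ [(e, v)]) e = valueSum s e + v := by
    simp [valueSum_append, valueSum_singleton]
  have htot : totalValue (s ++ [(e, v)]) = totalValue s + v := by
    rw [totalValue_append, totalValue_singleton]
  unfold SpaceSaving.insert
  split_ifs with h1 h2 h3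
  · refine ⟨μ, hT.nonneg, hT.card_le, ?_, ?_, hT.eq_zero, ?_, ?_, ?_, ?_⟩
    · have h4 := hT.sum_count
      simp only
      rw [← Finset.add_sum_erase _ _ h1] at h4 ⊢
      rw [htot, ← h4, Function.update_self, Finset.sum_congr rfl fun k hk =>
        Function.update_of_ne (Finset.ne_of_mem_erase hk) _ _]
      ring
    · intro k hk
      rcases eq_or_ne k e with rfl | hke
      · have := hT.le_count k hk; simp only [Function.update_self]; linarith
      · simpa [hke] using hT.le_count k hk
    · intro k hk
      rcases eq_or_ne k e with rfl | hke
      · have := hT.valueSum_le_count k hk; simp only [Function.update_self]; linarith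
      · simpa [hke, hne] using hT.valueSum_le_count k hk
    · intro k hk
      rcases eq_or_ne k e with rfl | hke
      · have := hT.count_le k hk; simp only [Function.update_self]; linarith
      · simpa [hke, hne] using hT.count_le k hk
    · intro k hk
      have hke : k ≠ e := by rintro rfl; exact hk h1
      simpa [hke, hne] using hT.valueSum_le k hk
    · exact fun k hk => hsub k (Or.inr hk)
  · have hμ := hT.eq_zero h2
    subst hμ
    have he := hT.valueSum_le e h1
    have hupd : ∀ k ∈ T.keys, Function.update T.count e v k = T.count k := fun k hk =>
      Function.update_of_ne (by rintro rfl; exact h1 hk) _ _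
    have hkne : ∀ k ∈ T.keys, k ≠ e := by rintro k hk rfl; exact h1 hk
    refine ⟨0, le_rfl, ?_, ?_, ?_, fun _ => rfl, ?_, ?_, ?_, ?_⟩
    · simp only [Finset.card_insert_of_notMem h1]; omega
    · simp only [Finset.sum_insert h1, Function.update_self]
      rw [Finset.sum_congr rfl hupd, hT.sum_count, htot, add_comm]
    · intro k hk
      rcases Finset.mem_insert.1 hk with rfl | hk
      · simpa using hv.le
      · simpa [hupd k hk] using hT.le_count k hk
    · intro k hk
      rcases Finset.mem_insert.1 hk with rfl | hk
      · simp only [Function.update_self]; linarith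
      · simpa [hupd k hk, hne k (hkne k hk)] using hT.valueSum_le_count k hk
    · intro k hk
      rcases Finset.mem_insert.1 hk with rfl | hk
      · simp only [Function.update_self]; linarith
      · simpa [hupd k hk, hne k (hkne k hk)] using hT.count_le k hk
    · intro k hk
      simp only [Finset.mem_insert, not_or] at hk
      simpa [hne k hk.1] using hT.valueSum_le k hk.2
    · exact fun k hk => hsub k (by simpa using hk)
  · set a := (T.keys.exists_min_image T.count h3).choose with ha
    obtain ⟨ha1, ha2⟩ := (T.keys.exists_min_image T.count h3).choose_spec
    rw [← ha] at ha1 ha2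
    have hμa := hT.le_count a ha1
    have he := hT.valueSum_le e h1
    have hcard := Finset.card_erase_add_one ha1
    have hle := hT.card_le
    have he' : e ∉ T.keys.erase a := fun h => h1 (Finset.mem_of_mem_erase h)
    have hkne : ∀ k ∈ T.keys, k ≠ e := by rintro k hk rfl; exact h1 hk
    have hupd : ∀ k ∈ T.keys.erase a, Function.update T.count e (T.count a + v) k = T.count k :=
      fun k hk => Function.update_of_ne (hkne k (Finset.mem_of_mem_erase hk)) _ _
    refine ⟨T.count a, le_trans hT.nonneg hμa, ?_, ?_, ?_, ?_, ?_, ?_, ?_, ?_⟩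
    · simp only [Finset.card_insert_of_notMem he']; omega
    · simp only [Finset.sum_insert he', Function.update_self]
      rw [Finset.sum_congr rfl hupd, htot, ← hT.sum_count, ← Finset.add_sum_erase _ _ ha1]
      ring
    · intro k hk
      rcases Finset.mem_insert.1 hk with rfl | hk
      · simp only [Function.update_self]; linarith
      · simpa [hupd k hk] using ha2 k (Finset.mem_of_mem_erase hk)
    · simp only [Finset.card_insert_of_notMem he']
      intro h; omega
    · intro k hk
      rcases Finset.mem_insert.1 hk with rfl | hk
      · simp only [Function.update_self]; linarith
      · have hk' := Finset.mem_of_mem_erase hk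
        simpa [hupd k hk, hne k (hkne k hk')] using hT.valueSum_le_count k hk'
    · intro k hk
      rcases Finset.mem_insert.1 hk with rfl | hk
      · simp only [Function.update_self]; linarith
      · have hk' := Finset.mem_of_mem_erase hk
        have := hT.count_le k hk'
        simp only [hupd k hk, hne k (hkne k hk')]
        linarith
    · intro k hk
      simp only [Finset.mem_insert, Finset.mem_erase, not_or, not_and] at hk
      rw [hne k hk.1]
      rcases eq_or_ne k a with hka | hka
      · rw [hka]; exact hT.valueSum_le_count a ha1
      · exact (hT.valueSum_le k (hk.2 hka)).trans hμa
    · intro k hk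
      refine hsub k ?_
      rcases Finset.mem_insert.1 hk with rfl | hk
      · exact Or.inl rfl
      · exact Or.inr (Finset.mem_of_mem_erase hk)
  · rw [Finset.not_nonempty_iff_eq_empty] at h3
    simp [h3] at h2
    omega

lemma SpaceSaving.exists_tracks {m : ℕ} (hm : 0 < m) {s : List (K × ℝ)} (hs : ∀ a ∈ s, 0 < a.2) :
    ∃ μ, (run m s).Tracks m s μ := by
  induction s using List.reverseRecOn with
  | nil => exact ⟨0, by constructor <;> simp [run, SpaceSaving.empty, valueSum, totalValue]⟩
  | append_singleton s a ih =>
    obtain ⟨μ, h⟩ := ih fun b hb => hs b (by simp [hb])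
    rw [run_append_singleton]
    exact h.insert hm (valueSum_nonneg (fun b hb => hs b (by simp [hb])) a.1) (hs a (by simp))

/-- With all counters in use, compare excesses over `μ`: only monitored keys can have one, and the
counters dominate it. Since the counters sum to the total value, subtracting leaves the capped sums.
-/
lemma SpaceSaving.Tracks.mul_le {m : ℕ} {T : SpaceSaving K} {s : List (K × ℝ)} {μ : ℝ}
    (hT : T.Tracks m s μ) (hs : ∀ a ∈ s, 0 < a.2) {S : Finset K} (hS : ∀ a ∈ s, a.1 ∈ S) :
    m * μ ≤ ∑ k ∈ S, min (valueSum s k) μ := by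
  rcases hT.card_le.lt_or_eq with h | h
  · rw [hT.eq_zero h, mul_zero]
    exact Finset.sum_nonneg fun k _ => le_min (valueSum_nonneg hs k) le_rfl
  · have hsub : T.keys ⊆ S := by
      intro k hk
      obtain ⟨a, ha, rfl⟩ := hT.keys_subset k hk
      exact hS a ha
    have h1 : ∑ k ∈ S, (valueSum s k - min (valueSum s k) μ) ≤ ∑ k ∈ T.keys, (T.count k - μ) := by
      rw [← Finset.sum_subset hsub (f := fun k => valueSum s k - min (valueSum s k) μ)]
      · refine Finset.sum_le_sum fun k hk => ?_
        have := hT.valueSum_le_count k hk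
        have := hT.le_count k hk
        rcases min_cases (valueSum s k) μ with ⟨h, _⟩ | ⟨h, _⟩ <;> rw [h] <;> linarith
      · intro k _ hk
        rw [min_eq_left (hT.valueSum_le k hk), sub_self]
    rw [Finset.sum_sub_distrib, Finset.sum_sub_distrib, hT.sum_count, ← totalValue_eq_sum hS,
      Finset.sum_const, h, nsmul_eq_mul] at h1
    linarith

/-- The error of SpaceSaving is at most `τ` if the value sums capped at `τ` add up to less than
`m * τ`. -/
lemma SpaceSaving.abs_query_sub_le {m : ℕ} (hm : 0 < m) {s : List (K × ℝ)}
    (hs : ∀ a ∈ s, 0 < a.2) {S : Finset K} (hS : ∀ a ∈ s, a.1 ∈ S) {τ : ℝ} (hτ : 0 < τ)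
    (h : ∑ k ∈ S, min (valueSum s k) τ < m * τ) (e : K) :
    |(run m s).query m e - valueSum s e| ≤ τ := by
  obtain ⟨μ, hT⟩ := exists_tracks hm hs
  have key : ∀ μ, (run m s).Tracks m s μ → μ ≤ τ := by
    intro μ hT
    by_contra! hμ
    -- Raising the cap from `τ` to `μ` increases a capped value by at most the factor `μ / τ`.
    have h1 : ∑ k ∈ S, min (valueSum s k) μ ≤ ∑ k ∈ S, μ / τ * min (valueSum s k) τ := by
      refine Finset.sum_le_sum fun k _ => ?_
      have hq : 1 ≤ μ / τ := (one_le_div hτ).2 hμ.le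
      rcases min_cases (valueSum s k) τ with ⟨h, _⟩ | ⟨h, _⟩ <;> rw [h]
      · exact (min_le_left _ _).trans (le_mul_of_one_le_left (valueSum_nonneg hs k) hq)
      · rw [div_mul_cancel₀ _ hτ.ne']; exact min_le_right _ _
    rw [← Finset.mul_sum] at h1
    have h2 := hT.mul_le hs hS
    have h3 : μ / τ * ∑ k ∈ S, min (valueSum s k) τ < μ / τ * (m * τ) :=
      mul_lt_mul_of_pos_left h (div_pos (hτ.trans hμ) hτ)
    have h4 : μ / τ * (m * τ) = m * μ := by field_simp
    linarith
  have hpos := valueSum_nonneg hs e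
  have hμ := key μ hT
  unfold SpaceSaving.query
  split_ifs with h1 h2 h3
  · have := hT.valueSum_le_count e h1
    have := hT.count_le e h1
    rw [abs_le]; constructor <;> linarith
  · have := hT.valueSum_le e h1
    rw [abs_le]; constructor <;> linarith [hT.nonneg]
  · have hle : μ ≤ (run m s).keys.inf' h3 (run m s).count := Finset.le_inf' _ _ hT.le_count
    -- The reported least counter is itself an admissible `μ`, so `key` bounds it by `τ` as well.
    have hT' : (run m s).Tracks m s ((run m s).keys.inf' h3 (run m s).count) :=
      ⟨hT.nonneg.trans hle, hT.card_le, hT.sum_count, fun k hk => Finset.inf'_le _ hk,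
        fun h => absurd h h2, hT.valueSum_le_count, fun k hk => (hT.count_le k hk).trans (by linarith),
        fun k hk => (hT.valueSum_le k hk).trans hle, hT.keys_subset⟩
    have := key _ hT'
    have := hT'.valueSum_le e h1
    rw [abs_le]; constructor <;> linarith [hT'.nonneg]
  · rw [Finset.not_nonempty_iff_eq_empty] at h3
    simp [h3] at h2
    omega

end SpaceSaving

/-! ### The layers of the sketch -/

section Sketch

variable {K : Type*} [DecidableEq K] {d : ℕ} {w : Fin d → ℕ}

/-- The stream that is left of `s` after the listed layers. -/
def passOn (lam : Fin d → ℝ) (h : (i : Fin d) → K → Fin (w i)) (is : List (Fin d))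
    (s : List (K × ℝ)) : List (K × ℝ) :=
  is.foldl (fun s i => (layerRun (lam i) (h i) s).2) s

/-- The listed layers and the final summary of `S` are in the state that results when the stream
`s` passes through them one after the other. -/
def Sketch.Follows (lam : Fin d → ℝ) (m : ℕ) (h : (i : Fin d) → K → Fin (w i)) (S : Sketch K w) :
    List (Fin d) → List (K × ℝ) → Prop
  | [], s => S.last = SpaceSaving.run m s
  | i :: is, s => S.bucket i = (layerRun (lam i) (h i) s).1 ∧
      Sketch.Follows lam m h S is (layerRun (lam i) (h i) s).2

lemma Sketch.Follows.setBucket {lam : Fin d → ℝ} {m : ℕ} {h : (i : Fin d) → K → Fin (w i)}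
    {S : Sketch K w} {is : List (Fin d)} {s : List (K × ℝ)} (hS : S.Follows lam m h is s)
    {i : Fin d} (hi : i ∉ is) (j : Fin (w i)) (B : Bucket K) :
    (S.setBucket i j B).Follows lam m h is s := by
  induction is generalizing s with
  | nil => exact hS
  | cons i' is ih =>
    simp only [List.mem_cons, not_or] at hi
    refine ⟨?_, ih hS.2 hi.2⟩
    rw [← hS.1]
    simp [Sketch.setBucket, Function.update_of_ne (Ne.symm hi.1)]

lemma Sketch.insertLayers_bucket (lam : Fin d → ℝ) (m : ℕ) (h : (i : Fin d) → K → Fin (w i))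
    (e : K) {is : List (Fin d)} {i : Fin d} (hi : i ∉ is) (v : ℝ) (S : Sketch K w) :
    (insertLayers lam m h e is v S).bucket i = S.bucket i := by
  induction is generalizing v S with
  | nil => rfl
  | cons i' is ih =>
    simp only [List.mem_cons, not_or] at hi
    have hset : ∀ j B, (S.setBucket i' j B).bucket i = S.bucket i := fun j B => by
      simp [Sketch.setBucket, Function.update_of_ne hi.1]
    unfold Sketch.insertLayers
    split
    · exact hset _ _
    · rw [ih hi.2, hset]

/-- This exchanges the order of processing, from item by item to layer by layer. It works because an
insertion into later layers never touches an earlier one, hence the `Nodup` hypothesis. -/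
lemma Sketch.Follows.insertLayers {lam : Fin d → ℝ} {m : ℕ} {h : (i : Fin d) → K → Fin (w i)}
    {S : Sketch K w} {is : List (Fin d)} (his : is.Nodup) {s : List (K × ℝ)}
    (hS : S.Follows lam m h is s) (e : K) (v : ℝ) :
    (Sketch.insertLayers lam m h e is v S).Follows lam m h is (s ++ [(e, v)]) := by
  induction is generalizing s v S with
  | nil =>
    have : S.last = SpaceSaving.run m s := hS
    simp [Sketch.Follows, Sketch.insertLayers, SpaceSaving.run_append_singleton, this]
  | cons i is ih =>
    obtain ⟨hi, his⟩ := List.nodup_cons.1 his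
    obtain ⟨hb, hS⟩ := hS
    unfold Sketch.Follows
    rw [layerRun_append_singleton]
    unfold Sketch.insertLayers layerStep
    simp only [← hb]
    split
    · next B hB =>
      simp only [hB]
      refine ⟨by simp [Sketch.setBucket], ?_⟩
      simpa using hS.setBucket hi _ _
    · next B v' hB =>
      simp only [hB]
      refine ⟨?_, ?_⟩
      · rw [Sketch.insertLayers_bucket _ _ _ _ hi]
        simp [Sketch.setBucket]
      · simpa using ih his (hS.setBucket hi (h i e) B) v'

lemma Sketch.empty_follows (lam : Fin d → ℝ) (m : ℕ) (h : (i : Fin d) → K → Fin (w i))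
    (is : List (Fin d)) : (Sketch.empty K w).Follows lam m h is [] := by
  induction is with
  | nil => rfl
  | cons i is ih => exact ⟨rfl, ih⟩

lemma run_follows (lam : Fin d → ℝ) (m : ℕ) (h : (i : Fin d) → K → Fin (w i))
    (s : List (K × ℝ)) : (run lam m h s).Follows lam m h (List.finRange d) s := by
  induction s using List.reverseRecOn with
  | nil => exact Sketch.empty_follows _ _ _ _
  | append_singleton s a ih =>
    have : run lam m h (s ++ [a]) = (run lam m h s).insert lam m h a := by simp [run]
    rw [this]
    exact ih.insertLayers (List.nodup_finRange d) a.1 a.2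

lemma passOn_pos {lam : Fin d → ℝ} (hlam : ∀ i, 0 ≤ lam i) (h : (i : Fin d) → K → Fin (w i))
    (is : List (Fin d)) {s : List (K × ℝ)} (hs : ∀ a ∈ s, 0 < a.2) :
    ∀ a ∈ passOn lam h is s, 0 < a.2 := by
  induction is generalizing s with
  | nil => exact hs
  | cons i is ih => exact ih (layerRun_out_pos (hlam i) (h i) hs)

lemma passOn_keys (lam : Fin d → ℝ) (h : (i : Fin d) → K → Fin (w i))
    (is : List (Fin d)) {s : List (K × ℝ)} {S : Finset K} (hs : ∀ a ∈ s, a.1 ∈ S) :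
    ∀ a ∈ passOn lam h is s, a.1 ∈ S := by
  induction is generalizing s with
  | nil => exact hs
  | cons i is ih => exact ih (layerRun_out_keys (lam i) (h i) s hs)

/-- Only the hash values of keys in the stream matter, so probabilities reduce to averages over
finitely many functions. -/
lemma passOn_congr (lam : Fin d → ℝ) {h h' : (i : Fin d) → K → Fin (w i)}
    (is : List (Fin d)) {s : List (K × ℝ)} {S : Finset K} (hs : ∀ a ∈ s, a.1 ∈ S)
    (hh : ∀ i ∈ is, ∀ k ∈ S, h i k = h' i k) : passOn lam h is s = passOn lam h' is s := by
  induction is generalizing s with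
  | nil => rfl
  | cons i is ih =>
    have h1 : layerRun (lam i) (h i) s = layerRun (lam i) (h' i) s :=
      layerRun_congr _ fun a ha => hh i (by simp) _ (hs a ha)
    have h2 := ih (layerRun_out_keys (lam i) (h i) s hs) fun j hj => hh j (by simp [hj])
    unfold passOn at h2 ⊢
    rw [List.foldl_cons, List.foldl_cons, ← h1, h2]

/-- The value sum telescopes into the parts absorbed by the layers. Where the query stops, nothing
of the key was passed on, so the omitted tail is exactly zero. -/
lemma Sketch.Follows.abs_queryLayers_sub_le {lam : Fin d → ℝ} (hlam : ∀ i, 0 ≤ lam i) {m : ℕ}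
    {h : (i : Fin d) → K → Fin (w i)} {S : Sketch K w} {is : List (Fin d)} {s : List (K × ℝ)}
    (hS : S.Follows lam m h is s) (hs : ∀ a ∈ s, 0 < a.2) {e : K} {ε : ℝ} (hε : 0 ≤ ε)
    (hlast : |(SpaceSaving.run m (passOn lam h is s)).query m e -
      valueSum (passOn lam h is s) e| ≤ ε) :
    |Sketch.queryLayers lam m h S e is - valueSum s e| ≤ (is.map lam).sum + ε := by
  induction is generalizing s with
  | nil =>
    have : S.last = SpaceSaving.run m s := hS
    simpa [Sketch.queryLayers, this, passOn] using hlast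
  | cons i is ih =>
    have h1 := ih hS.2 (layerRun_out_pos (hlam i) (h i) hs) hlast
    have h2 := ReliableSketch.abs_query_sub_le (hlam i) (h i) hs e
    have h3 : 0 ≤ (is.map lam).sum :=
      List.sum_nonneg fun x hx => by
        obtain ⟨j, -, rfl⟩ := List.mem_map.1 hx
        exact hlam j
    rw [List.map_cons, List.sum_cons]
    unfold Sketch.queryLayers
    rw [← hS.1] at h2
    split_ifs with hquit
    · rw [hS.1] at hquit
      rw [valueSum_out_eq_zero (hlam i) (h i) hs hquit] at h2
      rw [abs_le] at h2 ⊢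
      constructor <;> linarith [h2.1, h2.2]
    · rw [abs_le] at h1 h2 ⊢
      constructor <;> linarith [h1.1, h1.2, h2.1, h2.2]

/-- The deterministic error bound: each layer contributes its threshold, and the SpaceSaving
summary contributes `τ` if little enough value is left for it. -/
lemma abs_estimate_sub_le {lam : Fin d → ℝ} (hlam : ∀ i, 0 ≤ lam i) {m : ℕ} (hm : 0 < m)
    (h : (i : Fin d) → K → Fin (w i)) {s : List (K × ℝ)} (hs : ∀ a ∈ s, 0 < a.2)
    {S : Finset K} (hS : ∀ a ∈ s, a.1 ∈ S) {τ : ℝ} (hτ : 0 < τ)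
    (hlast : ∑ k ∈ S, min (valueSum (passOn lam h (List.finRange d) s) k) τ < m * τ) (e : K) :
    |estimate lam m h s e - valueSum s e| ≤ ∑ i, lam i + τ := by
  have := (run_follows lam m h s).abs_queryLayers_sub_le hlam hs (e := e) hτ.le
    (SpaceSaving.abs_query_sub_le hm (passOn_pos hlam h _ hs) (passOn_keys lam h _ hS) hτ hlast e)
  rwa [← List.ofFn_eq_map, List.sum_ofFn] at this

end Sketch

/-! ### Averages over hash functions -/

section Averages

/-- Resampling one coordinate leaves the uniform average unchanged; this is the form of independence
used for keys and for layers. -/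
lemma expect_eq_expect_update {ι : Type*} [Fintype ι] [DecidableEq ι] {β : ι → Type*}
    [∀ i, Fintype (β i)] [∀ i, Nonempty (β i)] (i : ι) (F : (∀ j, β j) → ℝ) :
    𝔼 c, F c = 𝔼 a : β i, 𝔼 c, F (Function.update c i a) := by
  classical
  have h1 : 𝔼 p : (∀ j, β j) × β i, F p.1 = 𝔼 p : (∀ j, β j) × β i, F (Function.update p.1 i p.2) := by
    -- Swapping the `i`-th coordinate with the fresh value is an involution.
    refine Fintype.expect_equiv
      (Function.Involutive.toPerm (fun p => (Function.update p.1 i p.2, p.1 i)) ?_) _ _ ?_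
    · rintro ⟨c, a⟩; simp
    · rintro ⟨c, a⟩; simp [Function.Involutive.toPerm]
  rw [← Finset.univ_product_univ, Finset.expect_product, Finset.expect_product] at h1
  simp only [Fintype.expect_const] at h1
  rw [h1, Finset.expect_comm]

end Averages

/-! ### The collision potential -/

section Potential

variable {ι β : Type*} [DecidableEq β]

/-- The keys `k` of the list are thrown one after the other into the bins `c k`; the key `k` of
weight `g k` contributes `g k * min 1 (y / u)` if the load of its bin is then `y`. The initial loads
are `y`. -/
def potential (u : ℝ) (g : ι → ℝ) (c : ι → β) : List ι → (β → ℝ) → ℝ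
  | [], _ => 0
  | k :: ks, y => g k * min 1 (y (c k) / u) +
      potential u g c ks (Function.update y (c k) (y (c k) + g k))

/-- The part of the potential that belongs to the bin `j`. -/
def binPotential (u : ℝ) (g : ι → ℝ) (c : ι → β) (j : β) : List ι → ℝ → ℝ
  | [], _ => 0
  | k :: ks, y => if c k = j then g k * min 1 (y / u) + binPotential u g c j ks (y + g k)
      else binPotential u g c j ks y

lemma potential_eq_sum [Fintype β] (u : ℝ) (g : ι → ℝ) (c : ι → β) (ks : List ι) (y : β → ℝ) :
    potential u g c ks y = ∑ j, binPotential u g c j ks (y j) := by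
  induction ks generalizing y with
  | nil => simp [potential, binPotential]
  | cons k ks ih =>
    unfold potential binPotential
    rw [ih, ← Finset.add_sum_erase _ _ (Finset.mem_univ (c k)),
      ← Finset.add_sum_erase Finset.univ (fun j => if c k = j then _ else _)
        (Finset.mem_univ (c k)), if_pos rfl, Function.update_self, ← add_assoc]
    congr 1
    refine Finset.sum_congr rfl fun j hj => ?_
    have hj := Finset.ne_of_mem_erase hj
    rw [Function.update_of_ne hj, if_neg (Ne.symm hj)]

/-- One step of `binPotential_lower`. Below load `u` the left side is quadratic in the load, and the
offset `M` pays for the term x²/2, which the charge misses because it uses the load before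
insertion. Above `u` it grows with slope only 1/2. -/
lemma half_mul_min_le {u M x y W : ℝ} (hu : 0 < u) (hx : 0 ≤ x) (hxM : x ≤ M)
    (hy : 0 ≤ y) (hW : 0 ≤ W) (h : (y - M) / 2 * min 1 (y / u) ≤ W) :
    (y + x - M) / 2 * min 1 ((y + x) / u) ≤ W + x * min 1 (y / u) := by
  have hφ : 0 ≤ min 1 (y / u) := le_min zero_le_one (by positivity)
  have hφ' : 0 ≤ min 1 ((y + x) / u) := le_min zero_le_one (by positivity)
  rcases le_total (y + x - M) 0 with h0 | h0
  · nlinarith [mul_nonneg hx hφ]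
  rcases le_total u y with h1 | h1
  · have h2 : min 1 (y / u) = 1 := min_eq_left ((one_le_div hu).2 h1)
    rw [h2] at h ⊢
    nlinarith [min_le_left 1 ((y + x) / u)]
  · have h2 : min 1 (y / u) = y / u := min_eq_right ((div_le_one hu).2 h1)
    rw [h2] at h ⊢
    have h3 : (y + x - M) / 2 * min 1 ((y + x) / u) ≤ (y + x - M) / 2 * ((y + x) / u) :=
      mul_le_mul_of_nonneg_left (min_le_right _ _) (by linarith)
    have h4 : (y + x - M) / 2 * ((y + x) / u) =
        (y - M) / 2 * (y / u) + x * (y / u) - x * (M - x) / 2 / u := by field_simp; ring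
    have h5 : 0 ≤ x * (M - x) / 2 / u := by
      have := sub_nonneg.2 hxM
      positivity
    linarith

/-- `W` stands for the charge collected before the current list, which makes the induction over keys
go through. -/
lemma binPotential_lower {u M : ℝ} (hu : 0 < u) {g : ι → ℝ} {c : ι → β} {j : β} (ks : List ι)
    (hg : ∀ k ∈ ks, 0 ≤ g k) (hM : ∀ k ∈ ks, c k = j → g k ≤ M) {y W : ℝ} (hy : 0 ≤ y)
    (hW : 0 ≤ W) (h : (y - M) / 2 * min 1 (y / u) ≤ W) :
    (y + (ks.map fun k => if c k = j then g k else 0).sum - M) / 2 *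
      min 1 ((y + (ks.map fun k => if c k = j then g k else 0).sum) / u) ≤
        W + binPotential u g c j ks y := by
  induction ks generalizing y W with
  | nil => simpa [binPotential] using h
  | cons k ks ih =>
    have hg' : ∀ k ∈ ks, 0 ≤ g k := fun k hk => hg k (by simp [hk])
    have hM' : ∀ k ∈ ks, c k = j → g k ≤ M := fun k hk => hM k (by simp [hk])
    have hgk := hg k (by simp)
    unfold binPotential
    rw [List.map_cons, List.sum_cons]
    split_ifs with hj
    · have := ih hg' hM' (add_nonneg hy hgk) (W := W + g k * min 1 (y / u))
        (add_nonneg hW (mul_nonneg hgk (le_min zero_le_one (by positivity))))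
        (half_mul_min_le hu hgk (hM k (by simp) hj) hy hW h)
      rw [← add_assoc, ← add_assoc]
      exact this
    · rw [zero_add]
      exact ih hg' hM' hy hW h

lemma binPotential_nonneg {u : ℝ} (hu : 0 < u) {g : ι → ℝ} {c : ι → β} {j : β} (ks : List ι)
    (hg : ∀ k ∈ ks, 0 ≤ g k) {y : ℝ} (hy : 0 ≤ y) : 0 ≤ binPotential u g c j ks y := by
  induction ks generalizing y with
  | nil => simp [binPotential]
  | cons k ks ih =>
    have hg' : ∀ k ∈ ks, 0 ≤ g k := fun k hk => hg k (by simp [hk])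
    have hgk := hg k (by simp)
    unfold binPotential
    split_ifs
    · exact add_nonneg (mul_nonneg hgk (le_min zero_le_one (by positivity)))
        (ih hg' (add_nonneg hy hgk))
    · exact ih hg' hy

/-- If the bin `j` has load at least `u` without any single one of its keys, its load is at most
four times its potential. -/
lemma sum_le_four_mul_binPotential [Fintype ι] {u : ℝ} (hu : 0 < u) {g : ι → ℝ}
    (hg : ∀ k, 0 ≤ g k) (hgu : ∀ k, g k ≤ u) {c : ι → β} {j : β}
    (h : ∀ k, c k = j → u ≤ (∑ k', if c k' = j then g k' else 0) - g k) :
    (∑ k, if c k = j then g k else 0) ≤ 4 * binPotential u g c j Finset.univ.toList 0 := by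
  set T := ∑ k, if c k = j then g k else 0 with hT
  by_cases hne : ∃ k, c k = j
  · obtain ⟨k₀, hk₀⟩ := hne
    obtain ⟨k₁, hk₁, hmax⟩ := (Finset.univ.filter fun k => c k = j).exists_max_image g
      ⟨k₀, by simpa using hk₀⟩
    simp only [Finset.mem_filter, Finset.mem_univ, true_and] at hk₁ hmax
    have h1 := binPotential_lower hu (M := g k₁) (c := c) (j := j) Finset.univ.toList
      (fun k _ => hg k) (fun k _ hk => hmax k hk) (y := 0) (W := 0) le_rfl le_rfl (by simp)
    rw [Finset.sum_map_toList, ← hT, zero_add, zero_add] at h1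
    have h2 := h k₁ hk₁
    -- For the largest key, `T - g k₁ ≥ u ≥ g k₁`, so `T - g k₁` is at least `T / 2`; together with
    -- the 1/2 in `binPotential_lower` this gives the factor 4.
    have h3 : min 1 (T / u) = 1 := min_eq_left ((one_le_div hu).2 (by linarith [hg k₁]))
    rw [h3] at h1
    linarith [hgu k₁]
  · push Not at hne
    have : T = 0 := Finset.sum_eq_zero fun k _ => if_neg (hne k)
    rw [this]
    exact mul_nonneg (by norm_num) (binPotential_nonneg hu _ (fun k _ => hg k) le_rfl)

lemma potential_congr {u : ℝ} {g : ι → ℝ} {c c' : ι → β} {ks : List ι}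
    (h : ∀ k ∈ ks, c k = c' k) (y : β → ℝ) : potential u g c ks y = potential u g c' ks y := by
  induction ks generalizing y with
  | nil => rfl
  | cons k ks ih =>
    unfold potential
    rw [h k (by simp), ih fun k' hk' => h k' (by simp [hk'])]

lemma exp_le_one_add_two_mul {x : ℝ} (h0 : 0 ≤ x) (h1 : x ≤ 1) : Real.exp x ≤ 1 + 2 * x := by
  have := Real.abs_exp_sub_one_le (x := x) (by rwa [abs_of_nonneg h0])
  rw [abs_of_nonneg h0] at this
  linarith [le_abs_self (Real.exp x - 1)]

/-- Average over the bin of the first key: its factor is at most 1 + 2 (g/u)(y/u) by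
`exp_le_one_add_two_mul`, and the mean load over the bins is at most `T / card β`, wherever earlier
keys went. Then 1 + t ≤ exp t, and the bounds multiply along the list. -/
lemma expect_exp_potential_le [Fintype ι] [DecidableEq ι] [Fintype β] [Nonempty β] {u : ℝ}
    (hu : 0 < u) {g : ι → ℝ} (hg : ∀ k, 0 ≤ g k) (hgu : ∀ k, g k ≤ u) {T : ℝ} (ks : List ι)
    (hks : ks.Nodup) (y : β → ℝ) (hy : ∀ j, 0 ≤ y j) (hT : ∑ j, y j + (ks.map g).sum ≤ T) :
    𝔼 c : ι → β, Real.exp (potential u g c ks y / u) ≤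
      Real.exp (2 * (ks.map g).sum * T / (Fintype.card β * u ^ 2)) := by
  have hw : (0 : ℝ) < Fintype.card β := by exact_mod_cast Fintype.card_pos
  induction ks generalizing y with
  | nil => simp [potential]
  | cons k ks ih =>
    obtain ⟨hk, hks⟩ := List.nodup_cons.1 hks
    rw [List.map_cons, List.sum_cons] at hT ⊢
    have hsum : 0 ≤ (ks.map g).sum := List.sum_nonneg fun x hx => by
      obtain ⟨k', -, rfl⟩ := List.mem_map.1 hx
      exact hg k'
    have hstep : ∀ a : β, 𝔼 c : ι → β,
        Real.exp (potential u g (Function.update c k a) (k :: ks) y / u) ≤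
        (1 + 2 * (g k / u * (y a / u))) *
          Real.exp (2 * (ks.map g).sum * T / (Fintype.card β * u ^ 2)) := by
      intro a
      have h1 : ∀ c : ι → β, Real.exp (potential u g (Function.update c k a) (k :: ks) y / u) =
          Real.exp (g k / u * min 1 (y a / u)) *
            Real.exp (potential u g c ks (Function.update y a (y a + g k)) / u) := by
        intro c
        rw [← Real.exp_add, potential, Function.update_self,
          potential_congr (c := Function.update c k a) (c' := c) fun k' hk' =>
            Function.update_of_ne (by rintro rfl; exact hk hk') _ _]
        congr 1
        ring
      simp only [h1]
      rw [← Finset.mul_expect]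
      have hq0 : 0 ≤ g k / u := div_nonneg (hg k) hu.le
      have hq1 : g k / u ≤ 1 := (div_le_one hu).2 (hgu k)
      have hm0 : 0 ≤ min 1 (y a / u) := le_min zero_le_one (div_nonneg (hy a) hu.le)
      refine mul_le_mul ?_ ?_ (Finset.expect_nonneg fun c _ => (Real.exp_pos _).le) ?_
      · refine (exp_le_one_add_two_mul (mul_nonneg hq0 hm0)
          (mul_le_one₀ hq1 hm0 (min_le_left _ _))).trans ?_
        have := mul_le_mul_of_nonneg_left (min_le_right 1 (y a / u)) hq0
        linarith
      · refine ih hks _ (fun j => ?_) ?_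
        · rcases eq_or_ne j a with rfl | hj
          · simpa using add_nonneg (hy j) (hg k)
          · simpa [hj] using hy j
        · refine le_trans (le_of_eq ?_) hT
          rw [← Finset.add_sum_erase _ _ (Finset.mem_univ a),
            ← Finset.add_sum_erase _ y (Finset.mem_univ a), Function.update_self,
            Finset.sum_congr rfl fun j hj => Function.update_of_ne (Finset.ne_of_mem_erase hj) _ _]
          ring
      · have := div_nonneg (hy a) hu.le
        positivity
    rw [expect_eq_expect_update k]
    refine (Finset.expect_le_expect fun a _ => hstep a).trans ?_
    rw [← Finset.expect_mul, mul_add, add_mul, add_div, Real.exp_add]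
    refine mul_le_mul_of_nonneg_right ?_ (Real.exp_pos _).le
    rw [Finset.expect_add_distrib, Fintype.expect_const, ← Finset.mul_expect, ← Finset.mul_expect,
      ← Finset.expect_div, Fintype.expect_eq_sum_div_card]
    refine le_trans ?_ (Real.add_one_le_exp _)
    have h1 : ∑ j, y j ≤ T := by linarith [hg k]
    have h2 : 2 * (g k / u * ((∑ j, y j) / (Fintype.card β : ℝ) / u)) =
        2 * g k * (∑ j, y j) / (Fintype.card β * u ^ 2) := by field_simp
    have h3 : 2 * g k * (∑ j, y j) / (Fintype.card β * u ^ 2) ≤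
        2 * g k * T / (Fintype.card β * u ^ 2) := by
      have := hg k
      gcongr
    linarith

end Potential

/-! ### One layer -/

section OneLayer

variable {K β : Type*} [DecidableEq K]

/-- Extension of a function on `S` by an arbitrary value. -/
def extendHash [Nonempty β] {S : Finset K} (c : S → β) (k : K) : β :=
  if hk : k ∈ S then c ⟨k, hk⟩ else Classical.arbitrary β

lemma extendHash_coe [Nonempty β] {S : Finset K} (c : S → β) (k : S) : extendHash c (k : K) = c k := by
  simp [extendHash]

variable [DecidableEq β]

/-- Either one term reaches the cap and suffices alone, or the cap has no effect. -/
lemma le_sum_min {ι : Type*} {T : Finset ι} {f : ι → ℝ} {u : ℝ} (hf : ∀ k ∈ T, 0 ≤ f k)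
    (hu : 0 ≤ u) (h : u ≤ ∑ k ∈ T, f k) : u ≤ ∑ k ∈ T, min (f k) u := by
  by_cases hk : ∃ k ∈ T, u ≤ f k
  · obtain ⟨k, hk, hku⟩ := hk
    calc u = min (f k) u := (min_eq_right hku).symm
      _ ≤ _ := Finset.single_le_sum (f := fun k => min (f k) u)
        (fun k hk => le_min (hf k hk) hu) hk
  · push Not at hk
    rwa [Finset.sum_congr rfl fun k hkT => min_eq_left (hk k hkT).le]

/-- The capped value sums of the keys of a bucket that has passed on something add up to at least
half of the threshold, even without one of the keys. -/
lemma half_le_sum_min_sub {lam : ℝ} (hlam : 0 ≤ lam) (hash : K → β) {s : List (K × ℝ)}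
    (hs : ∀ a ∈ s, 0 < a.2) {S : Finset K} (hS : ∀ a ∈ s, a.1 ∈ S) {j : β}
    (hj : ∃ a ∈ (layerRun lam hash s).2, hash a.1 = j) {k : K} (hk : k ∈ S) (hkj : hash k = j) :
    lam / 2 ≤ (∑ k' ∈ S, if hash k' = j then min (valueSum s k') (lam / 2) else 0) -
      min (valueSum s k) (lam / 2) := by
  obtain ⟨a, ha, haj⟩ := hj
  have h1 := (layerRun_tracks hlam hash hs j).overflow
    (List.ne_nil_of_mem (a := a) (by simp [ha, haj])) k
  subst hkj
  rw [valueSum_filter_eq, totalValue_eq_sum (S := S.filter fun k' => hash k' = hash k)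
    (by simpa using fun a b hab h => ⟨hS (a, b) hab, h⟩)] at h1
  rw [Finset.sum_congr rfl (g := fun k' => valueSum s k') fun k' hk' => by
    rw [← (Finset.mem_filter.1 hk').2, valueSum_filter_eq]] at h1
  have hmem : k ∈ S.filter fun k' => hash k' = hash k := by simp [hk]
  rw [← Finset.sum_filter, ← Finset.add_sum_erase _ _ hmem, add_sub_cancel_left]
  rw [← Finset.add_sum_erase _ _ hmem, add_sub_cancel_left] at h1
  exact le_sum_min (fun k' _ => valueSum_nonneg hs k') (by linarith) (by linarith)

lemma valueSum_layerRun_le {lam : ℝ} (hlam : 0 ≤ lam) (hash : K → β) {s : List (K × ℝ)}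
    (hs : ∀ a ∈ s, 0 < a.2) (k : K) : valueSum (layerRun lam hash s).2 k ≤ valueSum s k := by
  have h := layerRun_tracks hlam hash hs (hash k)
  have h1 := h.absorbed_of_eq k
  have h2 := h.absorbed_of_ne k
  rw [valueSum_filter_eq, valueSum_filter_eq] at h1 h2
  by_cases hID : ((layerRun lam hash s).1 (hash k)).ID = some k
  · linarith [(h1 hID).1, h.no_le_yes]
  · linarith [(h2 hID).1]

variable [Fintype β]

lemma sum_min_layerRun_le {lam : ℝ} (hlam : 0 < lam) (hash : K → β) {s : List (K × ℝ)}
    (hs : ∀ a ∈ s, 0 < a.2) {S : Finset K} (hS : ∀ a ∈ s, a.1 ∈ S) :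
    ∑ k ∈ S, min (valueSum (layerRun lam hash s).2 k) (lam / 2) ≤
      4 * potential (lam / 2) (fun k : S => min (valueSum s k) (lam / 2)) (fun k : S => hash k)
        Finset.univ.toList 0 := by
  have hg : ∀ k : S, 0 ≤ min (valueSum s k) (lam / 2) := fun k =>
    le_min (valueSum_nonneg hs k) (by linarith)
  rw [potential_eq_sum, Finset.mul_sum]
  have h1 : ∑ k ∈ S, min (valueSum (layerRun lam hash s).2 k) (lam / 2) =
      ∑ j, ∑ k ∈ S, if hash k = j then min (valueSum (layerRun lam hash s).2 k) (lam / 2)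
        else 0 := by
    rw [Finset.sum_comm]
    simp
  rw [h1]
  refine Finset.sum_le_sum fun j _ => ?_
  by_cases hj : ∃ a ∈ (layerRun lam hash s).2, hash a.1 = j
  · refine le_trans ?_ (sum_le_four_mul_binPotential (half_pos hlam) hg
      (fun k => min_le_right _ _) fun k hk => ?_)
    · rw [Finset.sum_coe_sort S fun k => if hash k = j then min (valueSum s k) (lam / 2) else 0]
      refine Finset.sum_le_sum fun k _ => ?_
      split_ifs
      · exact min_le_min_right _ (valueSum_layerRun_le hlam.le hash hs k)
      · exact le_rfl
    · rw [Finset.sum_coe_sort S fun k => if hash k = j then min (valueSum s k) (lam / 2) else 0]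
      exact half_le_sum_min_sub hlam.le hash hs hS hj k.2 hk
  · push Not at hj
    rw [Finset.sum_eq_zero]
    · exact mul_nonneg (by norm_num) (binPotential_nonneg (half_pos hlam) _ (fun k _ => hg k) le_rfl)
    · intro k _
      split_ifs with hk
      · rw [valueSum_eq_zero, min_eq_left (by linarith)]
        rintro a ha rfl
        exact hj a ha hk
      · rfl

open Classical in
/-- The tail bound for the value that a layer passes on. -/
lemma expect_layerRun_le [Nonempty β] {lam : ℝ} (hlam : 0 < lam) {s : List (K × ℝ)}
    (hs : ∀ a ∈ s, 0 < a.2) {S : Finset K} (hS : ∀ a ∈ s, a.1 ∈ S) {b : ℝ}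
    (hb : 16 * (∑ k ∈ S, min (valueSum s k) (lam / 2)) ^ 2 ≤ b * (Fintype.card β * (lam / 2))) :
    𝔼 c : S → β, (if b < ∑ k ∈ S, min (valueSum (layerRun lam (extendHash c) s).2 k) (lam / 2)
      then (1 : ℝ) else 0) ≤ Real.exp (-b / (4 * lam)) := by
  set G := ∑ k ∈ S, min (valueSum s k) (lam / 2) with hG
  set g : S → ℝ := fun k => min (valueSum s k) (lam / 2)
  have hu : 0 < lam / 2 := half_pos hlam
  have hw : (0 : ℝ) < Fintype.card β := by exact_mod_cast Fintype.card_pos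
  have hg : ∀ k : S, 0 ≤ g k := fun k => le_min (valueSum_nonneg hs k) hu.le
  have hGsum : ((Finset.univ : Finset S).toList.map g).sum = G := by
    rw [Finset.sum_map_toList, hG, ← Finset.sum_coe_sort S]
  have h1 := expect_exp_potential_le (β := β) hu hg (fun k => min_le_right _ _) (T := G)
    Finset.univ.toList (Finset.nodup_toList _) 0 (fun _ => le_rfl) (by rw [hGsum]; simp)
  rw [hGsum] at h1
  have h2 : ∀ c : S → β,
      (if b < ∑ k ∈ S, min (valueSum (layerRun lam (extendHash c) s).2 k) (lam / 2)
        then (1 : ℝ) else 0) ≤ Real.exp (-(b / 4) / (lam / 2)) *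
          Real.exp (potential (lam / 2) g c Finset.univ.toList 0 / (lam / 2)) := by
    intro c
    split_ifs with h
    · have h3 := sum_min_layerRun_le hlam (extendHash c) hs hS
      simp only [extendHash_coe] at h3
      rw [← Real.exp_add, ← add_div]
      refine Real.one_le_exp (div_nonneg ?_ hu.le)
      linarith
    · positivity
  refine (Finset.expect_le_expect fun c _ => h2 c).trans ?_
  rw [← Finset.mul_expect]
  refine (mul_le_mul_of_nonneg_left h1 (Real.exp_pos _).le).trans ?_
  rw [← Real.exp_add, Real.exp_le_exp]
  -- The Markov factor is exp(-b / (2 lam)); by `hb` the moment bound costs at most half of that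
  -- exponent.
  have h4 : 2 * G * G / (Fintype.card β * (lam / 2) ^ 2) ≤ b / (4 * lam) := by
    rw [div_le_div_iff₀ (by positivity) (by positivity)]
    nlinarith
  have h5 : -(b / 4) / (lam / 2) = -b / (4 * lam) - b / (4 * lam) := by field_simp; ring
  linarith

end OneLayer

/-! ### All layers -/

section AllLayers

variable {K : Type*} [DecidableEq K] {d : ℕ} {w : Fin d → ℕ} [∀ i, NeZero (w i)]

open Classical in
/-- If the `i`-th layer turns a stream with property `good i` into one without property
`good (i + 1)` with probability at most `δ i`, the probability that a property is violated behind
the last layer is at most the sum of the `δ i`. -/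
lemma expect_passOn_le (lam : Fin d → ℝ) {S : Finset K} {good : ℕ → List (K × ℝ) → Prop}
    {δ : Fin d → ℝ} (hδ0 : ∀ i, 0 ≤ δ i) (hgood : ∀ n s, good n s → ∀ a ∈ s, a.1 ∈ S)
    (hδ : ∀ (i : Fin d) (s : List (K × ℝ)), good i s → 𝔼 c : S → Fin (w i),
      (if good (i + 1) (layerRun (lam i) (extendHash c) s).2 then (0 : ℝ) else 1) ≤ δ i)
    {s : List (K × ℝ)} (hs : good 0 s) :
    𝔼 c : (i : Fin d) → S → Fin (w i),
      (if good d (passOn lam (fun i => extendHash (c i)) (List.finRange d) s) then (0 : ℝ) else 1) ≤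
        ∑ i, δ i := by
  have key : ∀ n ≤ d, ∀ s, good n s → 𝔼 c : (i : Fin d) → S → Fin (w i),
      (if good d (passOn lam (fun i => extendHash (c i)) ((List.finRange d).drop n) s)
        then (0 : ℝ) else 1) ≤ (((List.finRange d).drop n).map δ).sum := by
    intro n hn
    induction hn using Nat.decreasingInduction with
    | self =>
      intro s hs
      rw [List.drop_eq_nil_of_le (by simp)]
      simp [passOn, hs]
    | of_succ n hn ih =>
      intro s hs
      have hnd := (List.nodup_finRange d).sublist (List.drop_sublist n _)
      rw [List.drop_eq_getElem_cons (by simpa using hn), List.getElem_finRange] at hnd ⊢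
      set i : Fin d := Fin.cast (by simp) (⟨n, by simpa using hn⟩ : Fin (List.finRange d).length)
      set is := (List.finRange d).drop (n + 1)
      have hi' : i ∉ is := (List.nodup_cons.1 hnd).1
      -- The hash function `a` of layer `i` is drawn separately. Given `a`, the input of the later
      -- layers is a fixed stream, to which the induction hypothesis applies if it is good.
      rw [expect_eq_expect_update i, List.map_cons, List.sum_cons]
      have h1 : ∀ a : S → Fin (w i), 𝔼 c : (i : Fin d) → S → Fin (w i),
          (if good d (passOn lam (fun j => extendHash (Function.update c i a j)) (i :: is) s)
            then (0 : ℝ) else 1) ≤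
          (if good (n + 1) (layerRun (lam i) (extendHash a) s).2 then (0 : ℝ) else 1) +
            (is.map δ).sum := by
        intro a
        have h2 : ∀ c : (i : Fin d) → S → Fin (w i),
            passOn lam (fun j => extendHash (Function.update c i a j)) (i :: is) s =
              passOn lam (fun j => extendHash (c j)) is (layerRun (lam i) (extendHash a) s).2 := by
          intro c
          rw [passOn, List.foldl_cons, Function.update_self]
          refine passOn_congr lam is (layerRun_out_keys _ _ _ (hgood n s hs)) fun j hj k _ => ?_
          rw [Function.update_of_ne (by rintro rfl; exact hi' hj)]
        simp only [h2]
        by_cases hg : good (n + 1) (layerRun (lam i) (extendHash a) s).2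
        · rw [if_pos hg, zero_add]
          exact ih _ hg
        · rw [if_neg hg]
          have h3 : 0 ≤ (is.map δ).sum := List.sum_nonneg fun x hx => by
            obtain ⟨j, -, rfl⟩ := List.mem_map.1 hx
            exact hδ0 j
          refine (Finset.expect_le Finset.univ_nonempty (a := 1) fun c _ => ?_).trans
            (by linarith)
          split_ifs <;> norm_num
      refine (Finset.expect_le_expect fun a _ => h1 a).trans ?_
      rw [Finset.expect_add_distrib, Fintype.expect_const]
      gcongr
      exact hδ i s hs
  have := key 0 (Nat.zero_le d) s hs
  rwa [List.drop_zero, ← List.ofFn_eq_map, List.sum_ofFn] at this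

end AllLayers

/-! ### From the hash functions to averages -/

section Transfer

variable {K : Type*} [DecidableEq K] {d : ℕ} {w : Fin d → ℕ} [∀ i, NeZero (w i)]
  {Ω : Type*} [MeasurableSpace Ω] {P : Measure Ω} [IsProbabilityMeasure P]

-- Independence and uniformity make the joint hash values on a finite key set uniform over all
-- functions.
omit [IsProbabilityMeasure P] in
lemma IsUniformHashing.measureReal_eq {h : (i : Fin d) → K → Ω → Fin (w i)}
    (hh : IsUniformHashing P h) (S : Finset K) (c : (i : Fin d) → S → Fin (w i)) :
    P.real {ω | (fun i (k : S) => h i k ω) = c} =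
      1 / Fintype.card ((i : Fin d) → S → Fin (w i)) := by
  have h1 := hh.indep.measure_inter_preimage_eq_mul (Finset.univ ×ˢ S)
    (sets := fun p => {extendHash (c p.1) p.2}) fun p _ => measurableSet_singleton _
  have h2 : {ω | (fun i (k : S) => h i k ω) = c} =
      ⋂ p ∈ (Finset.univ : Finset (Fin d)) ×ˢ S, h p.1 p.2 ⁻¹' {extendHash (c p.1) p.2} := by
    ext ω
    simp only [Set.mem_ofPred_eq, Finset.mem_product, Finset.mem_univ, true_and, Set.mem_iInter,
      Set.mem_preimage, Set.mem_singleton_iff, Prod.forall, funext_iff]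
    constructor
    · intro hω i k hk
      have := hω i ⟨k, hk⟩
      simpa [extendHash, hk] using this
    · intro hω i k
      simpa [extendHash_coe] using hω i k k.2
  have h3 : ∀ p : Fin d × K, (P (h p.1 p.2 ⁻¹' {extendHash (c p.1) p.2})).toReal = 1 / w p.1 :=
    fun p => hh.uniform p.1 p.2 _
  rw [Measure.real, h2, h1, ENNReal.toReal_prod, Finset.prod_congr rfl fun p _ => h3 p,
    Finset.prod_product]
  simp

open Classical in
lemma IsUniformHashing.measureReal_le {h : (i : Fin d) → K → Ω → Fin (w i)}
    (hh : IsUniformHashing P h) (S : Finset K) (Q : ((i : Fin d) → S → Fin (w i)) → Prop) :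
    P.real {ω | ¬ Q fun i k => h i k ω} ≤ 𝔼 c, if Q c then 0 else 1 := by
  have h1 : {ω | ¬ Q fun i k => h i k ω} ⊆
      ⋃ c ∈ Finset.univ.filter fun c => ¬ Q c, {ω | (fun i (k : S) => h i k ω) = c} := by
    intro ω hω
    simpa using hω
  refine (measureReal_mono h1 (measure_ne_top _ _)).trans ((measureReal_biUnion_finset_le _ _).trans ?_)
  rw [Finset.sum_congr rfl fun c _ => hh.measureReal_eq S c, Fintype.expect_eq_sum_div_card]
  rw [Finset.sum_filter, Finset.sum_div]
  refine Finset.sum_le_sum fun c _ => ?_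
  by_cases hc : Q c <;> simp [hc]

open Classical in
/-- It suffices to bound the average number of violations over all hash functions of the keys
in `S`. -/
lemma IsUniformHashing.one_sub_le {h : (i : Fin d) → K → Ω → Fin (w i)}
    (hh : IsUniformHashing P h) (S : Finset K) (Q : ((i : Fin d) → S → Fin (w i)) → Prop)
    {δ : ℝ} (hQ : 𝔼 c, (if Q c then (0 : ℝ) else 1) ≤ δ) {A : Set Ω}
    (hA : ∀ ω, Q (fun i k => h i k ω) → ω ∈ A) : 1 - δ ≤ P.real A := by
  have h1 : (Set.univ : Set Ω) ⊆ A ∪ {ω | ¬ Q fun i k => h i k ω} := by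
    intro ω _
    by_cases hω : Q fun i k => h i k ω
    · exact Or.inl (hA ω hω)
    · exact Or.inr hω
  have h2 := (measureReal_mono (μ := P) h1).trans (measureReal_union_le _ _)
  rw [probReal_univ] at h2
  linarith [hh.measureReal_le S Q]

end Transfer

/-! ### The parameters -/

section Parameters

variable {N Λ Δ Rw Rl x : ℝ}

/-- The left-hand side of the equation for the depth, at a natural number. -/
def depthFun (Rw Rl : ℝ) (n : ℕ) : ℝ := 1 / ((Rw * Rl) ^ 2 ^ n * Rw ^ n)

lemma depthFun_pos (hRw : 1 < Rw) (hRl : 1 < Rl) (n : ℕ) : 0 < depthFun Rw Rl n := by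
  unfold depthFun
  positivity

lemma depthFun_zero (hRw : 1 < Rw) (hRl : 1 < Rl) : Rw * Rl * depthFun Rw Rl 0 = 1 := by
  have : Rw ≠ 0 := by positivity
  have : Rl ≠ 0 := by positivity
  rw [depthFun, pow_zero, pow_zero, pow_one, mul_one, mul_one_div, div_self (by positivity)]

lemma two_mul_depthFun_succ_le (hRw : 1 < Rw) (hRl : 1 < Rl) (hR : 2 ≤ Rw * Rl) (n : ℕ) :
    2 * depthFun Rw Rl (n + 1) ≤ depthFun Rw Rl n := by
  unfold depthFun
  rw [mul_one_div]
  have h1 : 2 ≤ (Rw * Rl) ^ 2 ^ n :=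
    hR.trans (le_self_pow₀ (by linarith) (by positivity))
  have h2 : (Rw * Rl) ^ 2 ^ (n + 1) = (Rw * Rl) ^ 2 ^ n * (Rw * Rl) ^ 2 ^ n := by
    rw [pow_succ 2 n, mul_two, pow_add]
  rw [div_le_div_iff₀ (by positivity) (by positivity), one_mul, h2, pow_succ Rw n]
  have h3 : 0 < (Rw * Rl) ^ 2 ^ n * Rw ^ n := by positivity
  calc 2 * ((Rw * Rl) ^ 2 ^ n * Rw ^ n)
      ≤ (Rw * Rl) ^ 2 ^ n * ((Rw * Rl) ^ 2 ^ n * Rw ^ n) := by gcongr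
    _ ≤ (Rw * Rl) ^ 2 ^ n * ((Rw * Rl) ^ 2 ^ n * Rw ^ n) * Rw :=
        le_mul_of_one_le_right (by positivity) hRw.le
    _ = _ := by ring

/-- Halving at each step gives even the factor 2^k; linear growth is enough to make the failure
probabilities geometric. -/
lemma mul_le_depthFun (hRw : 1 < Rw) (hRl : 1 < Rl) (hR : 2 ≤ Rw * Rl) {n k : ℕ} {p : ℝ}
    (hp : 0 ≤ p) (h : p ≤ depthFun Rw Rl (n + k)) : (k + 1) * p ≤ depthFun Rw Rl n := by
  induction k generalizing n with
  | zero => simpa using h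
  | succ k ih =>
    have h1 := ih (n := n + 1) (by rwa [add_right_comm])
    have h2 := two_mul_depthFun_succ_le hRw hRl hR n
    push_cast
    have : 0 ≤ (k : ℝ) * p := by positivity
    linarith

lemma rpow_div_rpow_eq (hRw : 1 < Rw) (hRl : 1 < Rl) (y : ℝ) :
    Rl ^ y / (Rw * Rl) ^ ((2 : ℝ) ^ y + y) = 1 / ((Rw * Rl) ^ (2 : ℝ) ^ y * Rw ^ y) := by
  have h1 : 0 < Rw := by linarith
  have h2 : 0 < Rl := by linarith
  have h3 : 0 < Rl ^ y := Real.rpow_pos_of_pos h2 y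
  have h4 : 0 < Rw ^ y := Real.rpow_pos_of_pos h1 y
  rw [Real.rpow_add (by positivity), Real.mul_rpow (z := y) h1.le h2.le]
  field_simp

lemma depthFun_eq (n : ℕ) :
    depthFun Rw Rl n = 1 / ((Rw * Rl) ^ (2 : ℝ) ^ (n : ℝ) * Rw ^ (n : ℝ)) := by
  unfold depthFun
  rw [Real.rpow_natCast, Real.rpow_natCast, ← Real.rpow_natCast _ (2 ^ n)]
  norm_num

lemma one_div_rpow_mul_rpow_antitone (hRw : 1 < Rw) (hRl : 1 < Rl) {y z : ℝ} (h : y ≤ z) :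
    1 / ((Rw * Rl) ^ (2 : ℝ) ^ z * Rw ^ z) ≤ 1 / ((Rw * Rl) ^ (2 : ℝ) ^ y * Rw ^ y) := by
  have h1 : 0 < Rw := by linarith
  have h2 : 0 < Rl := by linarith
  have h3 : 1 ≤ Rw * Rl := by nlinarith
  refine one_div_le_one_div_of_le
    (mul_pos (Real.rpow_pos_of_pos (by positivity) _) (Real.rpow_pos_of_pos h1 _)) ?_
  refine mul_le_mul ?_ (Real.rpow_le_rpow_of_exponent_le hRw.le h)
    (Real.rpow_pos_of_pos h1 _).le (Real.rpow_pos_of_pos (by positivity) _).le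
  exact Real.rpow_le_rpow_of_exponent_le h3
    (Real.rpow_le_rpow_of_exponent_le (by norm_num) h)

/-- The value of `depthFun` at the depth. -/
def rootValue (N Λ Δ Rw Rl : ℝ) : ℝ := Delta₁ Rw Rl * (Λ / N) * Real.log (1 / Δ)

lemma IsDepthRoot.depthFun_le (hRw : 1 < Rw) (hRl : 1 < Rl) (hx : IsDepthRoot N Λ Δ Rw Rl x)
    {n : ℕ} (hn : x ≤ n) : depthFun Rw Rl n ≤ rootValue N Λ Δ Rw Rl := by
  unfold IsDepthRoot at hx
  rw [rootValue, ← hx, rpow_div_rpow_eq hRw hRl, depthFun_eq]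
  exact one_div_rpow_mul_rpow_antitone hRw hRl hn

lemma IsDepthRoot.le_depthFun (hRw : 1 < Rw) (hRl : 1 < Rl) (hx : IsDepthRoot N Λ Δ Rw Rl x)
    {n : ℕ} (hn : n ≤ x) : rootValue N Λ Δ Rw Rl ≤ depthFun Rw Rl n := by
  unfold IsDepthRoot at hx
  rw [rootValue, ← hx, rpow_div_rpow_eq hRw hRl, depthFun_eq]
  exact one_div_rpow_mul_rpow_antitone hRw hRl hn

/-- The bound for the value that is left after `n` of `d` layers, each key being counted with at
most half of the next threshold. -/
def valueBound (N Λ Δ Rw Rl : ℝ) (d n : ℕ) : ℝ :=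
  N * (Rw * Rl) / Rl ^ n * if n < d then depthFun Rw Rl n else rootValue N Λ Δ Rw Rl

lemma IsDepthRoot.le_valueBound (hN : 0 < N) (hRw : 1 < Rw) (hRl : 1 < Rl)
    (hx : IsDepthRoot N Λ Δ Rw Rl x) {n : ℕ} (hn : n ≤ ⌈x⌉₊) :
    N * (Rw * Rl) / Rl ^ n * depthFun Rw Rl n ≤ valueBound N Λ Δ Rw Rl ⌈x⌉₊ n := by
  unfold valueBound
  split_ifs with h
  · exact le_rfl
  · have : n = ⌈x⌉₊ := by omega
    have : x ≤ n := this ▸ Nat.le_ceil x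
    have := hx.depthFun_le hRw hRl this
    gcongr

lemma IsDepthRoot.le_valueBound_zero (hN : 0 < N) (hRw : 1 < Rw) (hRl : 1 < Rl)
    (hx : IsDepthRoot N Λ Δ Rw Rl x) : N ≤ valueBound N Λ Δ Rw Rl ⌈x⌉₊ 0 := by
  refine le_trans (le_of_eq ?_) (hx.le_valueBound hN hRw hRl (Nat.zero_le _))
  rw [pow_zero, div_one, mul_assoc, depthFun_zero hRw hRl, mul_one]

lemma le_width_mul_threshold (hN : 0 < N) (hΛ : 0 < Λ) (hRw : 1 < Rw) (hRl : 1 < Rl) (n : ℕ) :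
    4 * N * (Rw * Rl) ^ 6 / (Rw * Rl) ^ n ≤ width N Λ Rw Rl n * threshold Λ Rl n := by
  have h1 : 0 < Rw - 1 := by linarith
  have h2 : 0 < Rl - 1 := by linarith
  have h3 : sizeParam N Λ Rw Rl * (Rw - 1) / Rw ^ n ≤ width N Λ Rw Rl n := Nat.le_ceil _
  have h4 : 0 < threshold Λ Rl n := by unfold threshold; positivity
  refine le_trans (le_of_eq ?_) (mul_le_mul_of_nonneg_right h3 h4.le)
  unfold sizeParam threshold
  rw [mul_pow Rw Rl n]
  field_simp

lemma width_pos (hN : 0 < N) (hΛ : 0 < Λ) (hRw : 1 < Rw) (hRl : 1 < Rl) (n : ℕ) :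
    0 < width N Λ Rw Rl n := by
  have h1 : 0 < Rw - 1 := by linarith
  have h2 : 0 < Rl - 1 := by linarith
  unfold width sizeParam
  rw [Nat.ceil_pos]
  positivity

lemma threshold_pos (hΛ : 0 < Λ) (hRl : 1 < Rl) (n : ℕ) : 0 < threshold Λ Rl n := by
  have h2 : 0 < Rl - 1 := by linarith
  unfold threshold
  positivity

lemma threshold_succ_le (hΛ : 0 < Λ) (hRl : 1 < Rl) (n : ℕ) :
    threshold Λ Rl (n + 1) ≤ threshold Λ Rl n := by
  have h2 : 0 < Rl - 1 := by linarith
  unfold threshold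
  gcongr
  · exact hRl.le
  · omega

/-- The quadratic decay of the bounds. -/
lemma IsDepthRoot.sq_valueBound_le (hN : 0 < N) (hΛ : 0 < Λ) (hRw : 1 < Rw) (hRl : 1 < Rl)
    (hR : 2 ≤ Rw * Rl) (hx : IsDepthRoot N Λ Δ Rw Rl x) {n : ℕ} (hn : n < ⌈x⌉₊) :
    16 * valueBound N Λ Δ Rw Rl ⌈x⌉₊ n ^ 2 ≤ valueBound N Λ Δ Rw Rl ⌈x⌉₊ (n + 1) *
      (width N Λ Rw Rl (n + 1) * (threshold Λ Rl (n + 1) / 2)) := by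
  have h1 : 0 < Rw := by linarith
  have h2 : 0 < Rl := by linarith
  have h3 := hx.le_valueBound hN hRw hRl (n := n + 1) hn
  have h4 := le_width_mul_threshold hN hΛ hRw hRl (n + 1)
  have h5 := depthFun_pos hRw hRl (n + 1)
  have h6 : valueBound N Λ Δ Rw Rl ⌈x⌉₊ n = N * (Rw * Rl) / Rl ^ n * depthFun Rw Rl n := by
    rw [valueBound, if_pos hn]
  have h7 : (N * (Rw * Rl) / Rl ^ n * depthFun Rw Rl n) ^ 2 * (2 * (Rw * Rl) ^ 3) =
      N * (Rw * Rl) / Rl ^ (n + 1) * depthFun Rw Rl (n + 1) *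
        (4 * N * (Rw * Rl) ^ 6 / (Rw * Rl) ^ (n + 1) / 2) := by
    unfold depthFun
    rw [pow_succ 2 n, mul_two, pow_add]
    rw [mul_pow Rw Rl (n + 1)]
    field_simp
    ring
  -- The surplus (Rw Rl)^3 ≥ 8 left over from the exponent 6 in `sizeParam` yields the constant 16 =
  -- 2 · 8.
  have h8 : (2 : ℝ) ^ 3 ≤ (Rw * Rl) ^ 3 := by gcongr
  rw [h6]
  calc 16 * (N * (Rw * Rl) / Rl ^ n * depthFun Rw Rl n) ^ 2
      ≤ (N * (Rw * Rl) / Rl ^ n * depthFun Rw Rl n) ^ 2 * (2 * (Rw * Rl) ^ 3) := by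
        nlinarith [sq_nonneg (N * (Rw * Rl) / Rl ^ n * depthFun Rw Rl n)]
    _ = _ := h7
    _ ≤ _ := by
      refine mul_le_mul h3 (by linarith) (by positivity) (le_trans (by positivity) h3)

lemma log_one_div_pos (hΔ : 0 < Δ) (hΔ' : Δ < 1) : 0 < Real.log (1 / Δ) :=
  Real.log_pos ((one_lt_div hΔ).2 hΔ')

lemma mul_rootValue (hN : 0 < N) (hRl : 1 < Rl) (n : ℕ) :
    N * (Rw * Rl) / Rl ^ n * rootValue N Λ Δ Rw Rl =
      2 * (Rw * Rl) ^ 3 * Real.log (1 / Δ) * threshold Λ Rl n := by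
  unfold rootValue Delta₁ threshold
  field_simp

/-- The last bound uses `rootValue`, which makes it proportional to ln(1/Δ) times a threshold; going
back towards earlier layers, `depthFun` grows at least linearly in the distance from the end. -/
lemma IsDepthRoot.log_mul_le (hN : 0 < N) (hΛ : 0 < Λ) (hΔ : 0 < Δ) (hΔ' : Δ < 1) (hRw : 1 < Rw)
    (hRl : 1 < Rl) (hR : 2 ≤ Rw * Rl) (hx : IsDepthRoot N Λ Δ Rw Rl x) {n : ℕ} (hn : n < ⌈x⌉₊) :
    2 * Real.log (1 / Δ) * ((⌈x⌉₊ - n : ℕ) : ℝ) ≤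
      valueBound N Λ Δ Rw Rl ⌈x⌉₊ (n + 1) / (4 * threshold Λ Rl (n + 1)) := by
  have hL := log_one_div_pos hΔ hΔ'
  have ht := threshold_pos hΛ hRl (n + 1)
  have h2 : 0 < Rl - 1 := by linarith
  have hp : 0 ≤ rootValue N Λ Δ Rw Rl := by unfold rootValue Delta₁; positivity
  have h1 : ((⌈x⌉₊ - n : ℕ) : ℝ) / 2 * rootValue N Λ Δ Rw Rl ≤
      if n + 1 < ⌈x⌉₊ then depthFun Rw Rl (n + 1) else rootValue N Λ Δ Rw Rl := by
    split_ifs with h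
    · obtain ⟨k, hk⟩ := Nat.exists_eq_add_of_lt h
      have h3 : ((n + 1 + k : ℕ) : ℝ) ≤ x := by
        have : n + 1 + k < ⌈x⌉₊ := by omega
        exact (Nat.lt_ceil.1 this).le
      have h4 := mul_le_depthFun hRw hRl hR hp (hx.le_depthFun hRw hRl h3)
      -- Here n + 1 + k is d - 1, the last natural number below `x`; the factor k + 1 obtained there
      -- is at least (k + 2)/2.
      have h5 : ⌈x⌉₊ - n = k + 2 := by omega
      refine le_trans (mul_le_mul_of_nonneg_right ?_ hp) h4
      rw [h5]
      push_cast
      linarith [Nat.cast_nonneg (α := ℝ) k]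
    · have h5 : ⌈x⌉₊ - n = 1 := by omega
      rw [h5]
      push_cast
      linarith
  have h6 : 0 ≤ N * (Rw * Rl) / Rl ^ (n + 1) := by positivity
  have h7 := mul_le_mul_of_nonneg_left h1 h6
  have h8 : (2 : ℝ) ^ 3 ≤ (Rw * Rl) ^ 3 := by gcongr
  rw [mul_left_comm, mul_rootValue hN hRl] at h7
  rw [le_div_iff₀ (by positivity)]
  refine le_trans ?_ h7
  have h9 : 0 ≤ ((⌈x⌉₊ - n : ℕ) : ℝ) * Real.log (1 / Δ) * threshold Λ Rl (n + 1) := by positivity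
  nlinarith [mul_le_mul_of_nonneg_left h8 h9]

/-- The terms are Δ² raised to d, ..., 1: a geometric series of sum at most 2Δ² ≤ Δ. -/
lemma sum_exp_le (hΔ : 0 < Δ) (hΔ' : Δ < 1 / 4) (d : ℕ) :
    ∑ i : Fin d, Real.exp (-(2 * Real.log (1 / Δ) * ((d - i : ℕ) : ℝ))) ≤ Δ := by
  have h1 : ∀ n : ℕ, Real.exp (-(2 * Real.log (1 / Δ) * (n : ℝ))) = (Δ ^ 2) ^ n := by
    intro n
    rw [one_div, Real.log_inv, ← pow_mul, ← Real.exp_log (pow_pos hΔ (2 * n)), Real.log_pow]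
    congr 1
    push_cast
    ring
  simp only [h1]
  rw [Fin.sum_univ_eq_sum_range (fun i => (Δ ^ 2) ^ (d - i)) d, ← Finset.sum_range_reflect]
  have h2 : ∑ j ∈ Finset.range d, (Δ ^ 2) ^ (d - (d - 1 - j)) =
      Δ ^ 2 * ∑ j ∈ Finset.range d, (Δ ^ 2) ^ j := by
    rw [Finset.mul_sum]
    refine Finset.sum_congr rfl fun j hj => ?_
    have := Finset.mem_range.1 hj
    rw [← pow_succ']
    congr 1
    omega
  have h3 := mul_neg_geom_sum (Δ ^ 2) d
  have h4 : 0 ≤ (Δ ^ 2) ^ d := by positivity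
  rw [h2]
  have h5 : Δ ^ 2 ≤ 1 / 16 := by nlinarith
  have h6 : ∑ j ∈ Finset.range d, (Δ ^ 2) ^ j ≤ 2 := by
    have : 0 ≤ ∑ j ∈ Finset.range d, (Δ ^ 2) ^ j := Finset.sum_nonneg fun _ _ => by positivity
    nlinarith
  nlinarith

lemma valueBound_last_lt (hN : 0 < N) (hΛ : 0 < Λ) (hΔ : 0 < Δ) (hΔ' : Δ < 1) (hRw : 1 < Rw)
    (hRl : 1 < Rl) (d : ℕ) :
    valueBound N Λ Δ Rw Rl d d <
      ⌈Delta₂ Rw Rl * Real.log (1 / Δ)⌉₊ * (threshold Λ Rl (d + 1) / 2) := by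
  have hL := log_one_div_pos hΔ hΔ'
  have ht := threshold_pos hΛ hRl d
  have ht' := threshold_pos hΛ hRl (d + 1)
  have h1 : threshold Λ Rl d = Rl * threshold Λ Rl (d + 1) := by
    unfold threshold
    rw [pow_succ]
    field_simp
  have h2 := Nat.le_ceil (Delta₂ Rw Rl * Real.log (1 / Δ))
  rw [valueBound, if_neg (lt_irrefl d), mul_rootValue hN hRl, h1]
  refine lt_of_lt_of_le ?_ (mul_le_mul_of_nonneg_right h2 (half_pos ht').le)
  unfold Delta₂
  have h3 : 0 < Rw ^ 3 * Rl ^ 4 * Real.log (1 / Δ) * threshold Λ Rl (d + 1) := by positivity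
  linarith

/-- The thresholds telescope to Λ - Λ / Rl^n, so d + 1 of them still stay below Λ. -/
lemma sum_threshold_add_le (hΛ : 0 < Λ) (hRl : 1 < Rl) (d : ℕ) :
    ∑ i : Fin d, threshold Λ Rl (i + 1) + threshold Λ Rl (d + 1) / 2 ≤ Λ := by
  have h1 : ∀ n : ℕ, ∑ i ∈ Finset.range n, threshold Λ Rl (i + 1) = Λ - Λ / Rl ^ n := by
    intro n
    induction n with
    | zero => simp
    | succ n ih =>
      rw [Finset.sum_range_succ, ih, threshold, pow_succ]
      field_simp
      ring
  have h2 := threshold_pos hΛ hRl (d + 1)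
  have h3 := h1 (d + 1)
  have h4 : 0 < Λ / Rl ^ (d + 1) := by positivity
  rw [Finset.sum_range_succ] at h3
  rw [Fin.sum_univ_eq_sum_range fun i => threshold Λ Rl (i + 1)]
  linarith

end Parameters

/-! ### The error bound for all keys -/

/-- The property of the stream left after `n` of `d` layers that holds for all `n` with high
probability. -/
structure WithinBound {K : Type*} [DecidableEq K] (S : Finset K) (N Λ Δ Rw Rl : ℝ) (d n : ℕ)
    (s : List (K × ℝ)) : Prop where
  pos : ∀ a ∈ s, 0 < a.2
  keys : ∀ a ∈ s, a.1 ∈ S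
  sum_le : ∑ k ∈ S, min (valueSum s k) (threshold Λ Rl (n + 1) / 2) ≤ valueBound N Λ Δ Rw Rl d n

lemma one_sub_le_measureReal_abs_estimate {K : Type*} [DecidableEq K]
    {Ω : Type*} [MeasurableSpace Ω] {P : Measure Ω} [IsProbabilityMeasure P]
    {stream : List (K × ℝ)} (hne : stream ≠ []) (hpos : ∀ a ∈ stream, 0 < a.2)
    {N : ℝ} (hN : N = totalValue stream)
    {Λ Δ Rw Rl : ℝ} (hΛ : 0 < Λ) (hΔ : 0 < Δ) (hΔ' : Δ < 1 / 4)
    (hRw : 1 < Rw) (hRl : 1 < Rl) (hR : 2 ≤ Rw * Rl)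
    {x : ℝ} (hx : IsDepthRoot N Λ Δ Rw Rl x) {d : ℕ} (hd : d = ⌈x⌉₊)
    {m : ℕ} (hm : m = ⌈Delta₂ Rw Rl * Real.log (1 / Δ)⌉₊)
    {h : (i : Fin d) → K → Ω → Fin (width N Λ Rw Rl (i + 1))} (hh : IsUniformHashing P h) :
    1 - Δ ≤ P.real {ω | ∀ e : K,
      |estimate (fun i : Fin d => threshold Λ Rl (i + 1)) m (fun i k => h i k ω) stream e -
        valueSum stream e| ≤ Λ} := by
  classical
  have hΔ1 : Δ < 1 := by linarith
  have hNpos : 0 < N := by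
    obtain ⟨a, s, rfl⟩ := List.exists_cons_of_ne_nil hne
    have h1 := hpos a List.mem_cons_self
    have h2 := valueSum_le_totalValue (fun b hb => hpos b (List.mem_cons_of_mem a hb)) a.1
    have h3 := valueSum_nonneg (fun b hb => hpos b (List.mem_cons_of_mem a hb)) a.1
    rw [hN, ← List.singleton_append, totalValue_append, totalValue_singleton]
    linarith
  have : ∀ i : Fin d, NeZero (width N Λ Rw Rl (i + 1)) := fun i =>
    ⟨(width_pos hNpos hΛ hRw hRl _).ne'⟩
  have hmpos : 0 < m := by
    have := log_one_div_pos hΔ hΔ1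
    rw [hm, Nat.ceil_pos, Delta₂]
    positivity
  set S : Finset K := (stream.map Prod.fst).toFinset with hSdef
  have hS : ∀ a ∈ stream, a.1 ∈ S := fun a ha => by
    rw [hSdef, List.mem_toFinset]
    exact List.mem_map_of_mem ha
  set lam : Fin d → ℝ := fun i => threshold Λ Rl (i + 1) with hlam
  have hlam0 : ∀ i, 0 ≤ lam i := fun i => (threshold_pos hΛ hRl _).le
  set good : ℕ → List (K × ℝ) → Prop := WithinBound S N Λ Δ Rw Rl d
  have hzero : good 0 stream := by
    refine ⟨hpos, hS, ?_⟩
    have h1 := hx.le_valueBound_zero hNpos hRw hRl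
    rw [← hd] at h1
    refine le_trans ?_ h1
    rw [hN, totalValue_eq_sum hS]
    exact Finset.sum_le_sum fun k _ => min_le_left _ _
  have hstep : ∀ (i : Fin d) (s : List (K × ℝ)), good i s →
      𝔼 c : S → Fin (width N Λ Rw Rl (i + 1)),
        (if good (i + 1) (layerRun (lam i) (extendHash c) s).2 then (0 : ℝ) else 1) ≤
          Real.exp (-(2 * Real.log (1 / Δ) * ((d - i : ℕ) : ℝ))) := by
    rintro i s ⟨h1, h2, h3⟩
    have hi : (i : ℕ) < ⌈x⌉₊ := by rw [← hd]; exact i.2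
    have h4 := hx.sq_valueBound_le hNpos hΛ hRw hRl hR hi
    have h5 := hx.log_mul_le hNpos hΛ hΔ hΔ1 hRw hRl hR hi
    rw [← hd] at h4 h5
    have h0 : 0 ≤ ∑ k ∈ S, min (valueSum s k) (lam i / 2) := Finset.sum_nonneg fun k _ =>
      le_min (valueSum_nonneg h1 k) (half_pos (threshold_pos hΛ hRl _)).le
    have h6 := expect_layerRun_le (β := Fin (width N Λ Rw Rl (i + 1))) (lam := lam i)
      (threshold_pos hΛ hRl _) h1 h2 (b := valueBound N Λ Δ Rw Rl d (i + 1)) (by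
        rw [Fintype.card_fin]
        refine le_trans ?_ h4
        gcongr)
    refine le_trans (Finset.expect_le_expect fun c _ => ?_) (h6.trans ?_)
    · split_ifs with hg hb hb
      · exact zero_le_one
      · exact le_rfl
      · exact le_rfl
      · refine absurd ⟨layerRun_out_pos (hlam0 i) _ h1, layerRun_out_keys _ _ _ h2, ?_⟩ hg
        refine le_trans (Finset.sum_le_sum fun k _ => min_le_min_left _ ?_) (not_lt.1 hb)
        -- The tail bound caps at half of this layer's threshold, `WithinBound` at half of the next
        -- and smaller one.
        exact div_le_div_of_nonneg_right (threshold_succ_le hΛ hRl _) (by norm_num)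
    · rw [Real.exp_le_exp, neg_div]
      exact neg_le_neg h5
  have hfinal := (expect_passOn_le lam (fun i => (Real.exp_pos _).le) (fun n s hs => hs.keys) hstep
    hzero).trans (sum_exp_le hΔ hΔ' d)
  refine hh.one_sub_le S (fun c => good d (passOn lam (fun i => extendHash (c i))
    (List.finRange d) stream)) hfinal fun ω hω e => ?_
  have hcongr : passOn lam (fun i => extendHash fun k : S => h i k ω) (List.finRange d) stream =
      passOn lam (fun i k => h i k ω) (List.finRange d) stream :=
    passOn_congr lam _ hS fun i _ k hk => by simp [extendHash, hk]
  rw [hcongr] at hω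
  have hlast := valueBound_last_lt hNpos hΛ hΔ hΔ1 hRw hRl d
  rw [← hm] at hlast
  exact (abs_estimate_sub_le hlam0 hmpos _ hpos hS (half_pos (threshold_pos hΛ hRl _))
    (hω.sum_le.trans_lt hlast) e).trans (sum_threshold_add_le hΛ hRl d)

end

end ReliableSketch

theorem mainTheorem1 {K : Type*} [DecidableEq K] [Countable K]
    {Ω : Type*} [MeasurableSpace Ω] (P : Measure Ω) [IsProbabilityMeasure P]
    (stream : List (K × ℝ)) (hne : stream ≠ []) (hpos : ∀ a ∈ stream, 0 < a.2)
    (N : ℝ) (hN : N = ReliableSketch.totalValue stream)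
    (Λ Δ Rw Rl : ℝ) (hΛ : 0 < Λ) (hΔ : 0 < Δ) (hΔ' : Δ < 1 / 4)
    (hRw : 1 < Rw) (hRl : 1 < Rl) (hR : 2 ≤ Rw * Rl)
    (x : ℝ) (hx : ReliableSketch.IsDepthRoot N Λ Δ Rw Rl x)
    (d : ℕ) (hd : d = ⌈x⌉₊)
    (m : ℕ) (hm : m = ⌈ReliableSketch.Delta₂ Rw Rl * Real.log (1 / Δ)⌉₊)
    (h : (i : Fin d) → K → Ω → Fin (ReliableSketch.width N Λ Rw Rl (i + 1)))
    (hh : ReliableSketch.IsUniformHashing P h) :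
    1 - Δ ≤ P.real {ω | ∀ e : K,
      |ReliableSketch.estimate (fun i : Fin d => ReliableSketch.threshold Λ Rl (i + 1)) m
          (fun i k => h i k ω) stream e - ReliableSketch.valueSum stream e| ≤ Λ} ∧
    ∀ e : K, 1 - Δ ≤ P.real {ω |
      |ReliableSketch.estimate (fun i : Fin d => ReliableSketch.threshold Λ Rl (i + 1)) m
          (fun i k => h i k ω) stream e - ReliableSketch.valueSum stream e| ≤ Λ} := by
  have hall := ReliableSketch.one_sub_le_measureReal_abs_estimate hne hpos hN hΛ hΔ hΔ' hRw hRl hR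
    hx hd hm hh
  exact ⟨hall, fun e => hall.trans (measureReal_mono fun ω hω => hω e)⟩
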